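/- **Setting.** Let ${\bf k}$ be an algebraically closed field, $N$ a lattice of finite rank with dual lattice $M$, and $\Sigma$ a finite smooth fan in $N$ with rays $\varrho_1,\dots,\varrho_n$ and first lattice points $\rho_i\in\varrho_i$. Let $A=\bigoplus_{m\ge 0}A_m$ be a commutative graded ${\bf k}$-algebra with finite-dimensional graded pieces. Let $\mathfrak v$ be a valuation on $A$ with values in functions $|\Sigma|\cap N\to\mathbb Z\cup\{\infty\}$ (with pointwise operations $\min,+$): $\mathfrak v(fg)=\mathfrak v(f)+\mathfrak v(g)$, $\mathfrak v(f+g)\ge\min(\mathfrak v(f),\mathfrak v(g))$, $\mathfrak v(c)=0$ for $c\in{\bf k}\setminus\{0\}$, $\mathfrak v(0)=\infty$. Assume that $\mathfrak v$ defines a flat graded toric sheaf of algebras, i.e. that * $\mathfrak v$ is homogeneous: $\mathfrak v(\sum_m f_m)=\min_m\mathfrak v(f_m)$ for $f_m\in A_m$; * for each $\sigma\in\Sigma$ there is a linear adapted basis: a ${\bf k}$-basis $(\beta_b)$ of $A$ and $m_b\in M$ with $\mathfrak v(\sum_b c_b\beta_b)(\rho)=\min\{\langle\rho,m_b\rangle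 : c_b\ne0\}$ for all $\rho\in\sigma\cap N$. (In particular $\mathfrak v(f)$ is finite, integral and piecewise linear for $f\neq 0$.) Write $\mathfrak v_\rho(f)=\mathfrak v(f)(\rho)$. A set $\mathcal B\subset A$ is a *Khovanskii basis* of $(A,\mathfrak v)$ if it generates the ${\bf k}$-algebra $A$ and, for every $\rho\in|\Sigma|\cap N$, the classes of its elements generate the associated graded algebra $\operatorname{gr}_{\mathfrak v_\rho}(A)=\bigoplus_{r\in\mathbb Z}\{\mathfrak v_\rho\ge r\}/\{\mathfrak v_\rho>r\}$ as a ${\bf k}$-algebra. The *total section ring* is $\mathcal R(A,\hat{\mathfrak v})=\bigoplus_\psi F_\psi(\mathfrak v)$, $F_\psi(\mathfrak v)=\{f\in A : \mathfrak v(f)\ge\psi\}$, where $\psi$ runs over the integral support functions of $\Sigma$ (functions on $|\Sigma|\cap N$ which agree on each cone with an element of $M$; they form a group isomorphic to $\mathbb Z^n$ via $\psi\mapsto(\psi(\rho_i))_i$). It is an algebra over the Cox ring ${\bf k}[X_1,\dots,X_n]$ of the toric variety of $\Sigma$, where $X_i$ is $1\in F_\psi(\mathfrak v)$ for the $\psi$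 with $\psi(\rho_i)=-1$ and $\psi(\rho_j)=0$ for $j\ne i$. The inclusions $F_\psi(\mathfrak v)\subset A$ induce the natural quotient map $\mathcal R(A,\hat{\mathfrak v})\to A$, which sends every $X_i$ to $1$. A set $\mathcal B\subset A$ is a *strong Khovanskii basis* if it is the image under this map of a set of homogeneous elements which generates $\mathcal R(A,\hat{\mathfrak v})$ as a ${\bf k}[X_1,\dots,X_n]$-algebra. **Theorem 1.4.** Let $\mathcal B=\{b_1,\dots,b_d\}\subset A\setminus\{0\}$ be a finite Khovanskii basis of $(A,\mathfrak v)$. Let $\mathcal I_{\mathcal B}$ be the kernel of the map $${\bf k}[X_1,\dots,X_n,Y_1,\dots,Y_d]\to A\otimes_{\bf k}{\bf k}[t_1^{\pm1},\dots,t_n^{\pm1}],\qquad X_i\mapsto 1\otimes t_i^{-1},\quad Y_j\mapsto b_j\otimes \prod_{i=1}^n t_i^{\mathfrak v(b_j)(\rho_i)}.$$ Then $\mathcal B$ is a strong Khovanskii basis if and only if the ideal $\langle\mathcal I_{\mathcal B},X_i\rangle$ is prime for every $i=1,\dots,n$. -/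

import Mathlib

/-! ## Smooth fans and their integral support functions -/

/-- A (finite) smooth fan in the lattice `N`.  A smooth cone is the cone spanned by a part of a
`ℤ`-basis of `N`; it is recorded by the finite set of its primitive ray generators.  The faces of
such a cone are the cones spanned by the subsets of its set of generators, and the lattice points
of the cone are the `ℕ`-linear combinations of the generators. -/
structure SmoothFan (N : Type*) [AddCommGroup N] where
  /-- The cones of the fan, each given by its set of primitive ray generators. -/
  cones : Finset (Finset N)
  /-- The zero cone belongs to the fan. -/
  empty_mem : ∅ ∈ cones
  /-- Every face of a cone of the fan belongs to the fan. -/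
  face_mem : ∀ σ ∈ cones, ∀ τ ⊆ σ, τ ∈ cones
  /-- Every cone is spanned by a part of a `ℤ`-basis of the lattice. -/
  smooth : ∀ σ ∈ cones, ∃ e : Module.Basis (Fin (Module.finrank ℤ N)) ℤ N,
    (σ : Set N) ⊆ Set.range e
  /-- Two cones of the fan intersect in a common face. -/
  inter_le : ∀ σ ∈ cones, ∀ τ ∈ cones,
    AddSubmonoid.closure (σ : Set N) ⊓ AddSubmonoid.closure (τ : Set N) ≤
      AddSubmonoid.closure ((σ : Set N) ∩ (τ : Set N))

namespace SmoothFan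

/-- The lattice points of the support `|F|` of the fan. -/
def supp {N : Type*} [AddCommGroup N] (F : SmoothFan N) : Set N :=
  {ρ | ∃ σ ∈ F.cones, ρ ∈ AddSubmonoid.closure (σ : Set N)}

/-- The rays of the fan, each given by its first lattice point `ρ_i`. -/
def Ray {N : Type*} [AddCommGroup N] (F : SmoothFan N) : Type _ :=
  {ρ : N // {ρ} ∈ F.cones}

/-- The first lattice point of a ray, as a lattice point of the support. -/
def rayPoint {N : Type*} [AddCommGroup N] (F : SmoothFan N) (i : F.Ray) : F.supp :=
  ⟨i.1, {i.1}, i.2, AddSubmonoid.subset_closure (by simp)⟩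

/-- The group of integral support functions of the fan: functions `ψ` on the lattice points of
`|F|` whose restriction to every cone is the restriction of an element of the dual lattice.
For a smooth fan with `n` rays, this group is `ℤⁿ`, through the values at the rays; it is the group
of torus invariant divisors on the toric variety of `F`. -/
def supportFunctions {N : Type*} [AddCommGroup N] (F : SmoothFan N) :
    AddSubgroup (F.supp → ℤ) where
  carrier := {ψ | ∀ σ ∈ F.cones, ∃ m : N →+ ℤ,
    ∀ ρ : F.supp, (ρ : N) ∈ AddSubmonoid.closure (σ : Set N) → ψ ρ = m ρ}
  add_mem' := by
    intro a b ha hb σ hσ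
    obtain ⟨m, hm⟩ := ha σ hσ
    obtain ⟨m', hm'⟩ := hb σ hσ
    exact ⟨m + m', fun ρ hρ => by simp [hm ρ hρ, hm' ρ hρ]⟩
  zero_mem' := fun σ _ => ⟨0, fun ρ _ => by simp⟩
  neg_mem' := by
    intro a ha σ hσ
    obtain ⟨m, hm⟩ := ha σ hσ
    exact ⟨-m, fun ρ hρ => by simp [hm ρ hρ]⟩

end SmoothFan

/-! ## The algebra `⨁ F_g` of a multiplicative family of subspaces -/

theorem coeff_mul_mem_of_forall {k A G : Type*} [Field k] [CommRing A] [Algebra k A]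
    [AddCommGroup G] (H : G → Submodule k A) (x y : AddMonoidAlgebra A G)
    (h : ∀ p q, x.coeff p * y.coeff q ∈ H (p + q)) (g : G) : (x * y).coeff g ∈ H g := by
  classical
  rw [AddMonoidAlgebra.coeff_mul]
  unfold Finsupp.sum
  refine Submodule.sum_mem _ fun p _ => Submodule.sum_mem _ fun q _ => ?_
  beta_reduce
  split_ifs with hg
  · exact hg ▸ h p q
  · exact Submodule.zero_mem _

/-- The direct sum `⨁_g F_g`, with its multiplication inherited from `A`, realised as the
subalgebra `⨁_g F_g t^g` of the group algebra `A[G]`. -/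
def gradedSubalgebra {k A G : Type*} [Field k] [CommRing A] [Algebra k A] [AddCommGroup G]
    (F : G → Submodule k A) (one_mem : 1 ∈ F 0)
    (mul_mem : ∀ p q a b, a ∈ F p → b ∈ F q → a * b ∈ F (p + q)) :
    Subalgebra k (AddMonoidAlgebra A G) where
  carrier := {x | ∀ g, x.coeff g ∈ F g}
  mul_mem' := fun {x y} hx hy =>
    coeff_mul_mem_of_forall F x y fun p q => mul_mem p q _ _ (hx p) (hy q)
  add_mem' := fun {x y} hx hy g => by
    rw [AddMonoidAlgebra.coeff_add]
    exact Submodule.add_mem _ (hx g) (hy g)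
  algebraMap_mem' := fun c g => by
    classical
    rw [AddMonoidAlgebra.coe_algebraMap, Function.comp_apply,
      AddMonoidAlgebra.coeff_single, Finsupp.single_apply]
    split_ifs with hg
    · rw [← hg, Algebra.algebraMap_eq_smul_one]
      exact Submodule.smul_mem _ _ one_mem
    · exact Submodule.zero_mem _

/-! ## Valuations with values in `ℤ ∪ {∞}` and their associated graded algebras -/

/-- A valuation `A → ℤ ∪ {∞}` over `k`, trivial on `k`. -/
structure IntValuation (k A : Type*) [Field k] [CommRing A] [Algebra k A] where
  /-- The underlying function. -/
  toFun : A → WithTop ℤ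
  map_mul : ∀ f g, toFun (f * g) = toFun f + toFun g
  map_add : ∀ f g, min (toFun f) (toFun g) ≤ toFun (f + g)
  map_const : ∀ c : k, c ≠ 0 → toFun (algebraMap k A c) = 0
  map_zero : toFun 0 = ⊤

namespace IntValuation

theorem map_one {k A : Type*} [Field k] [CommRing A] [Algebra k A] (w : IntValuation k A) :
    w.toFun 1 = 0 := by
  simpa using w.map_const 1 one_ne_zero

theorem le_map_smul {k A : Type*} [Field k] [CommRing A] [Algebra k A] (w : IntValuation k A)
    (c : k) (f : A) : w.toFun f ≤ w.toFun (c • f) := by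
  rw [Algebra.smul_def, w.map_mul]
  rcases eq_or_ne c 0 with rfl | hc
  · simp [w.map_zero]
  · simp [w.map_const c hc]

/-- The filtration step `G_r = {f | w(f) ≥ r}`. -/
def G {k A : Type*} [Field k] [CommRing A] [Algebra k A] (w : IntValuation k A) (r : ℤ) :
    Submodule k A where
  carrier := {f | (r : WithTop ℤ) ≤ w.toFun f}
  add_mem' := fun {f g} hf hg => (le_min hf hg).trans (w.map_add f g)
  zero_mem' := by simp [w.map_zero]
  smul_mem' := fun c f hf => le_trans hf (w.le_map_smul c f)

/-- The filtration step `G_{>r} = {f | w(f) > r}`. -/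
def Ggt {k A : Type*} [Field k] [CommRing A] [Algebra k A] (w : IntValuation k A) (r : ℤ) :
    Submodule k A where
  carrier := {f | (r : WithTop ℤ) < w.toFun f}
  add_mem' := fun {f g} hf hg => (lt_min hf hg).trans_le (w.map_add f g)
  zero_mem' := by simp [w.map_zero]
  smul_mem' := fun c f hf => lt_of_lt_of_le hf (w.le_map_smul c f)

/-- The algebra `⨁_r G_r`, as the subalgebra `⨁_r G_r t^r` of `A[t^±]`. -/
def rees {k A : Type*} [Field k] [CommRing A] [Algebra k A] (w : IntValuation k A) :
    Subalgebra k (AddMonoidAlgebra A ℤ) :=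
  gradedSubalgebra w.G (show (((0 : ℤ) : WithTop ℤ)) ≤ w.toFun 1 by simp [w.map_one])
    (fun p q a b ha hb => by
      change ((p + q : ℤ) : WithTop ℤ) ≤ w.toFun (a * b)
      rw [w.map_mul, WithTop.coe_add]
      exact add_le_add ha hb)

/-- The ideal `⨁_r G_{>r}` of `⨁_r G_r`. -/
def grIdeal {k A : Type*} [Field k] [CommRing A] [Algebra k A] (w : IntValuation k A) :
    Ideal w.rees where
  carrier := {x | ∀ r, (x : AddMonoidAlgebra A ℤ).coeff r ∈ w.Ggt r}
  add_mem' := fun {x y} hx hy r => Submodule.add_mem _ (hx r) (hy r)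
  zero_mem' := fun r => Submodule.zero_mem _
  smul_mem' := fun c x hx r =>
    coeff_mul_mem_of_forall w.Ggt (c : AddMonoidAlgebra A ℤ) (x : AddMonoidAlgebra A ℤ)
      (fun p q => by
        have hc : (p : WithTop ℤ) ≤ w.toFun ((c : AddMonoidAlgebra A ℤ).coeff p) := c.2 p
        have hq : (q : WithTop ℤ) < w.toFun ((x : AddMonoidAlgebra A ℤ).coeff q) := hx q
        change ((p + q : ℤ) : WithTop ℤ) < w.toFun _
        rw [w.map_mul, WithTop.coe_add]
        exact WithTop.add_lt_add_of_le_of_lt (WithTop.coe_ne_top) hc hq) r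

/-- The associated graded algebra `gr_w(A) = ⨁_r G_r / G_{>r}`, i.e. the quotient of `⨁_r G_r`
by `⨁_r G_{>r}`. -/
abbrev gr {k A : Type*} [Field k] [CommRing A] [Algebra k A] (w : IntValuation k A) : Type _ :=
  w.rees ⧸ w.grIdeal

theorem single_mem_rees {k A : Type*} [Field k] [CommRing A] [Algebra k A]
    (w : IntValuation k A) (f : A) :
    AddMonoidAlgebra.single ((w.toFun f).untopD 0) f ∈ w.rees := by
  classical
  intro r
  rw [AddMonoidAlgebra.coeff_single, Finsupp.single_apply]
  split_ifs with hr
  · change (r : WithTop ℤ) ≤ w.toFun f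
    rw [← hr]
    cases h : w.toFun f <;> simp
  · exact Submodule.zero_mem _

/-- The equivalence class of `f` in `gr_w(A)`: the class of `f` in `G_r / G_{>r}` for `r = w(f)`
(and `0` when `w(f) = ∞`). -/
noncomputable def initialForm {k A : Type*} [Field k] [CommRing A] [Algebra k A] (w : IntValuation k A)
    (f : A) : w.gr :=
  Ideal.Quotient.mk w.grIdeal
    ⟨AddMonoidAlgebra.single ((w.toFun f).untopD 0) f, w.single_mem_rees f⟩

/-- `B` is a Khovanskii basis of `w`: the classes of the elements of `B` generate `gr_w(A)` as a
`k`-algebra. -/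
def IsKhovanskiiBasis {k A : Type*} [Field k] [CommRing A] [Algebra k A] (w : IntValuation k A)
    (B : Set A) : Prop :=
  Algebra.adjoin k (w.initialForm '' B) = ⊤

end IntValuation

/-! ## Valuations with values in functions on the support of a fan -/

/-- A valuation on `A` over `k` whose values are functions `|F| ∩ N → ℤ ∪ {∞}`, with the pointwise
operations `min` and `+`, and the pointwise order. -/
structure FanValuation (k : Type*) {N : Type*} (A : Type*) [Field k] [AddCommGroup N]
    [CommRing A] [Algebra k A] (F : SmoothFan N) where
  /-- The underlying function. -/
  toFun : A → F.supp → WithTop ℤ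
  map_mul : ∀ f g, toFun (f * g) = toFun f + toFun g
  map_add : ∀ f g ρ, min (toFun f ρ) (toFun g ρ) ≤ toFun (f + g) ρ
  map_const : ∀ c : k, c ≠ 0 → toFun (algebraMap k A c) = 0
  map_zero : toFun 0 = ⊤

namespace FanValuation

/-- The valuation `v_ρ : A → ℤ ∪ {∞}`, `v_ρ(f) = v(f)(ρ)`. -/
def atPoint {k N A : Type*} [Field k] [AddCommGroup N] [CommRing A] [Algebra k A]
    {F : SmoothFan N} (v : FanValuation k A F) (ρ : F.supp) : IntValuation k A where
  toFun := fun f => v.toFun f ρ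
  map_mul := fun f g => by simp [v.map_mul f g]
  map_add := fun f g => v.map_add f g ρ
  map_const := fun c hc => by simp [v.map_const c hc]
  map_zero := by simp [v.map_zero]

/-- For every cone `σ` of the fan, the restriction `v|_σ` has a linear adapted basis: a `k`-basis
`β` of `A`, with elements `m_b` of the dual lattice, such that
`v(∑ c_b β_b)(ρ) = min {m_b(ρ) | c_b ≠ 0}` for the lattice points `ρ` of `σ`.
In particular, the values of `v` on nonzero elements are then finite, integral and piecewise linear
with finitely many domains of linearity. -/
def HasLinearAdaptedBases.{u} {k N : Type*} {A : Type u} [Field k] [AddCommGroup N] [CommRing A]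
    [Algebra k A] {F : SmoothFan N} (v : FanValuation k A F) : Prop :=
  ∀ σ ∈ F.cones, ∃ (κ : Type u) (β : Module.Basis κ k A) (m : κ → N →+ ℤ),
    ∀ (f : A) (ρ : F.supp), (ρ : N) ∈ AddSubmonoid.closure (σ : Set N) →
      v.toFun f ρ = (β.repr f).support.inf fun b => ((m b (ρ : N) : ℤ) : WithTop ℤ)

/-- `v` is homogeneous for the grading `𝒜`, i.e. `(A, v)` is the direct sum of the `(𝒜 n, v|_{𝒜 n})`:
the value of `f` is the minimum of the values of its homogeneous components.  (The inequality `≥`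
always holds.) -/
def IsHomogeneous {k N A : Type*} [Field k] [AddCommGroup N] [CommRing A] [Algebra k A]
    {F : SmoothFan N} (v : FanValuation k A F) (𝒜 : ℕ → Submodule k A) [GradedAlgebra 𝒜] : Prop :=
  ∀ (f : A) (n : ℕ), v.toFun f ≤ v.toFun (DirectSum.decompose 𝒜 f n : A)

/-- `B` is a Khovanskii basis of `(A, v)`: it generates the algebra `A`, and it is a Khovanskii
basis of `v_ρ` for every lattice point `ρ` of the support of the fan. -/
def IsKhovanskiiBasis {k N A : Type*} [Field k] [AddCommGroup N] [CommRing A] [Algebra k A]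
    {F : SmoothFan N} (v : FanValuation k A F) (B : Set A) : Prop :=
  Algebra.adjoin k B = ⊤ ∧ ∀ ρ : F.supp, (v.atPoint ρ).IsKhovanskiiBasis B

/-! ### The total section ring and strong Khovanskii bases -/

/-- The space `F_ψ(v) = {f | v(f) ≥ ψ}` for an integral support function `ψ`. -/
def sectionSpace {k N A : Type*} [Field k] [AddCommGroup N] [CommRing A] [Algebra k A]
    {F : SmoothFan N} (v : FanValuation k A F) (ψ : F.supportFunctions) : Submodule k A :=
  ⨅ ρ : F.supp, (v.atPoint ρ).G ((ψ : F.supp → ℤ) ρ)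

theorem mem_sectionSpace {k N A : Type*} [Field k] [AddCommGroup N] [CommRing A] [Algebra k A]
    {F : SmoothFan N} (v : FanValuation k A F) (ψ : F.supportFunctions) (f : A) :
    f ∈ v.sectionSpace ψ ↔
      ∀ ρ : F.supp, (((ψ : F.supp → ℤ) ρ : ℤ) : WithTop ℤ) ≤ v.toFun f ρ := by
  simp only [sectionSpace, Submodule.mem_iInf]
  rfl

/-- The total section ring `R(A, v̂) = ⨁_ψ F_ψ(v)`, the sum over all integral support functions
(torus linearized line bundles), realised as `⨁_ψ F_ψ(v) t^ψ`. -/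
def sectionRing {k N A : Type*} [Field k] [AddCommGroup N] [CommRing A] [Algebra k A]
    {F : SmoothFan N} (v : FanValuation k A F) :
    Subalgebra k (AddMonoidAlgebra A F.supportFunctions) :=
  gradedSubalgebra v.sectionSpace
    (by
      rw [mem_sectionSpace]
      intro ρ
      have h : v.toFun 1 ρ = 0 := (v.atPoint ρ).map_one
      simp [h])
    (fun p q a b ha hb => by
      rw [mem_sectionSpace] at ha hb ⊢
      intro ρ
      have h := add_le_add (ha ρ) (hb ρ)
      rw [v.map_mul]
      simpa using h)

/-- The natural quotient map `R(A, v̂) → A`, which sends every `t^ψ` to `1` and so maps the summand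
`F_ψ(v)` onto the subspace `F_ψ(v)` of `A`. -/
noncomputable def toFiber {k N A : Type*} [Field k] [AddCommGroup N] [CommRing A] [Algebra k A]
    {F : SmoothFan N} (v : FanValuation k A F) : v.sectionRing →ₐ[k] A :=
  (AddMonoidAlgebra.liftNCAlgHom (AlgHom.id k A)
    (1 : Multiplicative F.supportFunctions →* A) fun _ _ => Commute.all _ _).comp
      v.sectionRing.val

/-- The homogeneous elements of the total section ring. -/
def IsHomogeneousSection {k N A : Type*} [Field k] [AddCommGroup N] [CommRing A] [Algebra k A]
    {F : SmoothFan N} (v : FanValuation k A F) (s : v.sectionRing) : Prop :=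
  ∃ ψ f, (s : AddMonoidAlgebra A F.supportFunctions) = AddMonoidAlgebra.single ψ f

/-- The monomials of the Cox ring `k[X_1, …, X_n]` of the toric variety, inside the total section
ring: the elements `1 · t^φ` for the integral support functions `φ ≤ 0`.  The variable `X_i` is
`t^φ` for the `φ` with the value `-1` at `ρ_i` and `0` at the other rays. -/
def coxMonomials {k N A : Type*} [Field k] [AddCommGroup N] [CommRing A] [Algebra k A]
    {F : SmoothFan N} (v : FanValuation k A F) : Set v.sectionRing :=
  {s | ∃ φ : F.supportFunctions, (φ : F.supp → ℤ) ≤ 0 ∧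
    (s : AddMonoidAlgebra A F.supportFunctions) = AddMonoidAlgebra.single φ 1}

/-- `B` is a strong Khovanskii basis: it is the image in `A` of a set of homogeneous elements which
generates the total section ring as an algebra over the Cox ring of the toric variety. -/
def IsStrongKhovanskiiBasis {k N A : Type*} [Field k] [AddCommGroup N] [CommRing A] [Algebra k A]
    {F : SmoothFan N} (v : FanValuation k A F) (B : Set A) : Prop :=
  ∃ S : Set v.sectionRing, (∀ s ∈ S, v.IsHomogeneousSection s) ∧
    Algebra.adjoin k (v.coxMonomials ∪ S) = ⊤ ∧ v.toFiber '' S = B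

/-! ### The ideal presenting the lifted generators -/

/-- The vector `v̂(b)` of the values of `b` at the rays (for `b` with finite values). -/
def rayValues {k N A : Type*} [Field k] [AddCommGroup N] [CommRing A] [Algebra k A]
    {F : SmoothFan N} (v : FanValuation k A F) (b : A) : F.Ray → ℤ :=
  fun i => (v.toFun b (F.rayPoint i)).untopD 0

open Classical in
/-- The map `k[X, Y] → A ⊗ k[t_1^±, …, t_n^±] = A[ℤⁿ]`, `X_i ↦ t_i⁻¹`, `Y_b ↦ b t^{v̂(b)}`, with
one variable `X_i` for every ray and one variable `Y_b` for every `b ∈ B`. -/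
noncomputable def presentationMap {k N A : Type*} [Field k] [AddCommGroup N] [CommRing A]
    [Algebra k A] {F : SmoothFan N} (v : FanValuation k A F) (B : Set A) :
    MvPolynomial (F.Ray ⊕ B) k →ₐ[k] AddMonoidAlgebra A (F.Ray → ℤ) :=
  MvPolynomial.aeval (Sum.elim
    (fun i => AddMonoidAlgebra.single (-(Pi.single i 1)) 1)
    (fun b => AddMonoidAlgebra.single (v.rayValues b) (b : A)))

/-- The ideal `I_B`. -/
noncomputable def presentationIdeal {k N A : Type*} [Field k] [AddCommGroup N] [CommRing A]
    [Algebra k A] {F : SmoothFan N} (v : FanValuation k A F) (B : Set A) :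
    Ideal (MvPolynomial (F.Ray ⊕ B) k) :=
  RingHom.ker (v.presentationMap B)

end FanValuation

/-! ## Growth functions -/

/-! On each cone an adapted basis makes `v(f)` a minimum of linear functions, so a bound below by a
support function need only be checked at the rays. By smoothness support functions are arbitrary
functions on the rays. Hence the total section ring is `⨁ raySpace φ · t^φ`. The image of `k[X, Y]`
is the graded subalgebra `⨁ piece B φ · t^φ`, and `B` is strong exactly when the two agree.

If they agree, the quotient by `⟨I_B, X_i⟩` is the sum of the `raySpace φ / raySpace (φ + e_i)`. A
homogeneous class is nonzero there exactly when its value at `ρ_i` equals `φ i`. Values add under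
multiplication, so the quotient is a domain (`isPrime_of_raySpace_le_piece`).

Conversely, fix a ray `i`, let `w` be the valuation at `ρ_i`, and filter `A` by the spans of the
monomials in `B` of value at least `r`. Ignoring the degrees at the other rays, primality makes the
associated graded algebra `k[Y] / monomialIdeal` a domain. It maps onto `gr_w(A)` because `B` is a
Khovanskii basis. This map is injective by growth. Let `h(M)` and `g(M)` be the dimensions of the
images of the polynomials of degree at most `M` in the two algebras. Both are compared with
truncations of `A`, giving `h(M) ≤ dim A_{≤ DM} ≤ g(CM)`. Multiplication by a nonzero kernel element
of degree `d` is injective and lands in the kernel, so `h(M) + g(M + d) ≤ h(M + d)`. Iterating gives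
`M h(M) ≤ h((C + d) M)`, impossible for a polynomially bounded positive `h`.

Injectivity means that an element of the `r`-th filtration step with `w`-value at least `r + 1` is
in the next step (`mem_monomialFiltration_succ`). A second use of primality restores the degrees at
the other rays (`mem_piece_add_single`). Raising one coordinate at a time then shows that every
element of `raySpace φ` lies in `piece B φ`. -/

theorem mul_le_of_growth {h g : ℕ → ℕ} {C d : ℕ} (hg : Monotone g)
    (hgC : ∀ M, h M ≤ g (C * M)) (hd : ∀ M, h M + g (M + d) ≤ h (M + d)) (M j : ℕ) :
    j * h M ≤ h (C * M + j * d) := by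
  induction j with
  | zero => simp
  | succ j ih =>
    have h1 := hd (C * M + j * d)
    -- Starting from argument `C * M`, each increase by `d` adds at least `g (C * M) ≥ h M`.
    have h2 : g (C * M) ≤ g (C * M + j * d + d) := hg (by omega)
    have h3 := hgC M
    have e : C * M + (j + 1) * d = C * M + j * d + d := by ring
    rw [e]
    linarith

/-- Dividing `M * h M ≤ h (K * M)` by `M` turns a bound of exponent `e + 1` into one of exponent
`e`. At exponent zero `h` is bounded, which the inequality contradicts at `M = a + 1`. -/
theorem not_polynomially_bounded {h : ℕ → ℕ} {K : ℕ} (hK : 1 ≤ K) (hpos : ∀ M, 1 ≤ h M)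
    (hmul : ∀ M, M * h M ≤ h (K * M)) (e : ℕ) :
    ∀ a, ¬ ∀ M, h M ≤ a * (M + 1) ^ e := by
  induction e with
  | zero =>
    intro a ha
    have h1 := hmul (a + 1)
    have h2 := ha (K * (a + 1))
    have h3 := hpos (a + 1)
    nlinarith
  | succ e ih =>
    intro a ha
    -- The factor 2 absorbs `(M + 1) / M` for `M ≥ 1`; the summand `h 0` covers `M = 0`.
    refine ih (2 * a * K ^ (e + 1) + h 0) fun M => ?_
    rcases Nat.eq_zero_or_pos M with rfl | hM
    · simp
    have h1 : M * h M ≤ a * (K * (M + 1)) ^ (e + 1) := by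
      refine (hmul M).trans ((ha _).trans ?_)
      gcongr
      nlinarith
    have h2 : (M + 1) * h M ≤ (M + 1) * (2 * a * K ^ (e + 1) * (M + 1) ^ e) := by
      calc (M + 1) * h M ≤ 2 * (M * h M) := by nlinarith [hpos M]
        _ ≤ 2 * (a * (K * (M + 1)) ^ (e + 1)) := by gcongr
        _ = _ := by rw [mul_pow]; ring
    calc h M ≤ 2 * a * K ^ (e + 1) * (M + 1) ^ e := Nat.le_of_mul_le_mul_left h2 (by omega)
      _ ≤ _ := by gcongr; omega

/-- A polynomially bounded growth function `h` cannot dominate a discrete derivative that is itself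
bounded below by `h` up to rescaling. -/
theorem false_of_growth {h g : ℕ → ℕ} {C d e : ℕ} (hC : 1 ≤ C) (hpos : ∀ M, 1 ≤ h M)
    (hg : Monotone g) (hgC : ∀ M, h M ≤ g (C * M)) (hd : ∀ M, h M + g (M + d) ≤ h (M + d))
    (he : ∀ M, h M ≤ (M + 1) ^ e) : False := by
  refine not_polynomially_bounded (h := h) (K := C + d) (by omega) hpos (fun M => ?_) e 1
    (by simpa using he)
  have := mul_le_of_growth hg hgC hd M M
  rwa [show C * M + M * d = (C + d) * M by ring] at this

/-! ## Families of subspaces indexed by a group -/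

namespace AddMonoidAlgebra

theorem coeff_mul_mem {k A G : Type*} [Field k] [CommRing A] [Algebra k A] [AddCommGroup G]
    {P Q H : G → Submodule k A} (hPQ : ∀ p q, ∀ a ∈ P p, ∀ b ∈ Q q, a * b ∈ H (p + q))
    {x y : AddMonoidAlgebra A G} (hx : ∀ g, x.coeff g ∈ P g) (hy : ∀ g, y.coeff g ∈ Q g) (g : G) :
    (x * y).coeff g ∈ H g :=
  coeff_mul_mem_of_forall H x y (fun p q => hPQ p q _ (hx p) _ (hy q)) g

theorem coeff_single_mem {k A G : Type*} [Field k] [CommRing A] [Algebra k A]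
    {P : G → Submodule k A} {g : G} {a : A} (ha : a ∈ P g) (r : G) :
    (single g a).coeff r ∈ P r := by
  classical
  rw [coeff_single, Finsupp.single_apply]
  split_ifs with h
  · exact h ▸ ha
  · exact Submodule.zero_mem _

/-- Primality of a graded family can be tested on homogeneous elements, if the grading group has
unique sums. -/
theorem coeff_mem_or_coeff_mem_of_mul {k A G : Type*} [Field k] [CommRing A] [Algebra k A]
    [AddCommGroup G] [UniqueSums G] {P Q : G → Submodule k A}
    (hPQ : ∀ p q, ∀ a ∈ P p, ∀ b ∈ Q q, a * b ∈ Q (p + q))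
    (hprime : ∀ p q, ∀ a ∈ P p, ∀ b ∈ P q, a * b ∈ Q (p + q) → a ∈ Q p ∨ b ∈ Q q)
    {x y : AddMonoidAlgebra A G} (hx : ∀ g, x.coeff g ∈ P g) (hy : ∀ g, y.coeff g ∈ P g)
    (hxy : ∀ g, (x * y).coeff g ∈ Q g) : (∀ g, x.coeff g ∈ Q g) ∨ ∀ g, y.coeff g ∈ Q g := by
  classical
  by_contra! hcon
  obtain ⟨⟨p, hp⟩, ⟨q, hq⟩⟩ := hcon
  have hsupp : ∀ {z : AddMonoidAlgebra A G} {g : G}, z.coeff g ∉ Q g → g ∈ z.coeff.support := by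
    intro z g hg
    rw [Finsupp.mem_support_iff]
    intro h0
    exact hg (h0 ▸ Submodule.zero_mem _)
  -- Unique sums are applied only to degrees whose coefficient lies outside `Q`. All other
  -- contributions to the coefficient at `p + q` lie in `Q`, so `x_p * y_q` does too.
  obtain ⟨p, hpm, q, hqm, hu⟩ := UniqueSums.uniqueAdd_of_nonempty
    (A := x.coeff.support.filter fun g => x.coeff g ∉ Q g)
    (B := y.coeff.support.filter fun g => y.coeff g ∉ Q g)
    ⟨p, Finset.mem_filter.2 ⟨hsupp hp, hp⟩⟩ ⟨q, Finset.mem_filter.2 ⟨hsupp hq, hq⟩⟩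
  rw [Finset.mem_filter] at hpm hqm
  have key : x.coeff p * y.coeff q ∈ Q (p + q) := by
    have h1 := hxy (p + q)
    rw [coeff_mul] at h1
    unfold Finsupp.sum at h1
    rw [← Finset.sum_product', ← Finset.add_sum_erase _ _
      (Finset.mk_mem_product hpm.1 hqm.1)] at h1
    simp only [if_true] at h1
    refine (Submodule.add_mem_iff_left _ (Submodule.sum_mem _ fun z hz => ?_)).1 h1
    split_ifs with hz2
    · rw [Finset.mem_erase, Finset.mem_product] at hz
      by_cases hz3 : x.coeff z.1 ∈ Q z.1
      · rw [← hz2, mul_comm, add_comm z.1]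
        exact hPQ _ _ _ (hy _) _ hz3
      by_cases hz4 : y.coeff z.2 ∈ Q z.2
      · rw [← hz2]
        exact hPQ _ _ _ (hx _) _ hz4
      have := hu (Finset.mem_filter.2 ⟨hz.2.1, hz3⟩) (Finset.mem_filter.2 ⟨hz.2.2, hz4⟩) hz2
      exact absurd (Prod.ext this.1 this.2) hz.1
    · exact Submodule.zero_mem _
  rcases hprime p q _ (hx p) _ (hy q) key with h | h
  · exact hpm.2 h
  · exact hqm.2 h

end AddMonoidAlgebra

/-! ## Polynomials of bounded degree -/

namespace MvPolynomial

theorem finrank_restrictTotalDegree_le {k σ : Type*} [Field k] [Fintype σ] (M : ℕ) :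
    Module.finrank k (restrictTotalDegree σ k M) ≤ (M + 1) ^ Fintype.card σ := by
  classical
  let Z : Set (σ →₀ ℕ) := {a | a.sum (fun _ e => e) ≤ M}
  let f : Z → σ → Fin (M + 1) := fun a i => ⟨a.1 i, by
    have h2 : a.1.sum (fun _ e => e) ≤ M := a.2
    rw [Finsupp.sum_fintype _ _ (fun _ => rfl)] at h2
    have h1 := Finset.single_le_sum (f := fun i => a.1 i) (fun _ _ => Nat.zero_le _)
      (Finset.mem_univ i)
    omega⟩
  have hf : Function.Injective f := by
    intro a b hab
    apply Subtype.ext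
    ext i
    have := congrFun hab i
    simpa [f] using this
  have : Fintype Z := @Fintype.ofFinite _ (Finite.of_injective f hf)
  have e : Module.finrank k (restrictTotalDegree σ k M) = Fintype.card Z :=
    Module.finrank_eq_card_basis (basisRestrictSupport k Z)
  rw [e]
  simpa using Fintype.card_le_of_injective f hf

theorem restrictTotalDegree_eq_span {k σ : Type*} [Field k] (M : ℕ) :
    restrictTotalDegree σ k M =
      Submodule.span k ((fun a => monomial a (1 : k)) '' {a : σ →₀ ℕ | a.degree ≤ M}) := by
  apply le_antisymm
  · intro p hp
    rw [mem_restrictTotalDegree] at hp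
    rw [p.as_sum]
    refine Submodule.sum_mem _ fun a ha => ?_
    rw [← mul_one (p.coeff a), ← smul_eq_mul, ← smul_monomial]
    refine Submodule.smul_mem _ _ (Submodule.subset_span ⟨a, ?_, rfl⟩)
    exact (le_totalDegree ha).trans hp
  · rw [Submodule.span_le]
    rintro _ ⟨a, ha, rfl⟩
    rw [SetLike.mem_coe, mem_restrictTotalDegree, totalDegree_monomial _ one_ne_zero]
    exact ha

end MvPolynomial

/-! ## Initial forms -/

namespace IntValuation

section Initial

variable {k A : Type*} [Field k] [CommRing A] [Algebra k A] (w : IntValuation k A)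

theorem mem_G {r : ℤ} {f : A} : f ∈ w.G r ↔ (r : WithTop ℤ) ≤ w.toFun f := Iff.rfl

theorem mem_Ggt {r : ℤ} {f : A} : f ∈ w.Ggt r ↔ (r : WithTop ℤ) < w.toFun f := Iff.rfl

theorem mem_Ggt_iff_mem_G {r : ℤ} {f : A} : f ∈ w.Ggt r ↔ f ∈ w.G (r + 1) := by
  rw [mem_Ggt, mem_G]
  cases h : w.toFun f with
  | top => simp
  | coe a =>
    rw [WithTop.coe_lt_coe, WithTop.coe_le_coe]
    omega

theorem mul_mem_G {p q : ℤ} {a b : A} (ha : a ∈ w.G p) (hb : b ∈ w.G q) :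
    a * b ∈ w.G (p + q) := by
  rw [mem_G] at *
  rw [w.map_mul, WithTop.coe_add]
  exact add_le_add ha hb

/-- The element `f t^{w(f)}` of the Rees algebra. -/
noncomputable def lead (f : A) : w.rees :=
  ⟨AddMonoidAlgebra.single ((w.toFun f).untopD 0) f, w.single_mem_rees f⟩

theorem initialForm_eq (f : A) : w.initialForm f = Ideal.Quotient.mk w.grIdeal (w.lead f) := rfl

theorem mk_eq_mk_iff {x y : w.rees} :
    Ideal.Quotient.mk w.grIdeal x = Ideal.Quotient.mk w.grIdeal y ↔
      ∀ r, (x : AddMonoidAlgebra A ℤ).coeff r - (y : AddMonoidAlgebra A ℤ).coeff r ∈ w.Ggt r := by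
  rw [Ideal.Quotient.eq]
  exact Iff.rfl

theorem mk_eq_zero_iff {x : w.rees} :
    Ideal.Quotient.mk w.grIdeal x = 0 ↔
      ∀ r, (x : AddMonoidAlgebra A ℤ).coeff r ∈ w.Ggt r := by
  rw [Ideal.Quotient.eq_zero_iff_mem]
  exact Iff.rfl

theorem untopD_coe {f : A} (hf : w.toFun f ≠ ⊤) :
    (((w.toFun f).untopD 0 : ℤ) : WithTop ℤ) = w.toFun f := by
  cases h : w.toFun f with
  | top => exact absurd h hf
  | coe a => rfl

theorem isDomain (hw : ∀ f, f ≠ 0 → w.toFun f ≠ ⊤) : IsDomain A := by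
  have : Nontrivial A := ⟨1, 0, fun h => by simpa [h, w.map_zero] using w.map_one⟩
  have : NoZeroDivisors A := ⟨fun {a b} hab => by
    by_contra! hcon
    have h := w.map_mul a b
    rw [hab, w.map_zero, eq_comm, WithTop.add_eq_top] at h
    exact h.elim (hw a hcon.1) (hw b hcon.2)⟩
  exact NoZeroDivisors.to_isDomain A

theorem untopD_map_mul {x y : A} (hx : w.toFun x ≠ ⊤) (hy : w.toFun y ≠ ⊤) :
    (w.toFun (x * y)).untopD 0 = (w.toFun x).untopD 0 + (w.toFun y).untopD 0 := by
  apply WithTop.coe_injective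
  rw [WithTop.coe_add, w.untopD_coe hx, w.untopD_coe hy, ← w.map_mul, w.untopD_coe]
  rw [w.map_mul]
  exact WithTop.add_ne_top.2 ⟨hx, hy⟩

theorem lead_zero : w.lead 0 = 0 := by
  apply Subtype.ext
  simp [lead]

theorem lead_mul (hw : ∀ f, f ≠ 0 → w.toFun f ≠ ⊤) (x y : A) :
    w.lead (x * y) = w.lead x * w.lead y := by
  by_cases hx : x = 0
  · simp [hx, lead_zero]
  by_cases hy : y = 0
  · simp [hy, lead_zero]
  apply Subtype.ext
  change AddMonoidAlgebra.single _ _ = AddMonoidAlgebra.single _ _ * AddMonoidAlgebra.single _ _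
  rw [AddMonoidAlgebra.single_mul_single, w.untopD_map_mul (hw x hx) (hw y hy)]

theorem lead_one : w.lead 1 = 1 := by
  apply Subtype.ext
  change AddMonoidAlgebra.single _ _ = (1 : AddMonoidAlgebra A ℤ)
  rw [w.map_one, AddMonoidAlgebra.one_def]
  rfl

theorem lead_algebraMap (c : k) : w.lead (algebraMap k A c) = algebraMap k w.rees c := by
  by_cases hc : c = 0
  · simp [hc, lead_zero]
  apply Subtype.ext
  change AddMonoidAlgebra.single _ _ = algebraMap k (AddMonoidAlgebra A ℤ) c
  rw [w.map_const c hc, AddMonoidAlgebra.coe_algebraMap]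
  rfl

/-- The map `f ↦ f t^{w(f)}`, as a multiplicative map. -/
noncomputable def leadHom (hw : ∀ f, f ≠ 0 → w.toFun f ≠ ⊤) : A →* w.rees where
  toFun := w.lead
  map_one' := w.lead_one
  map_mul' := w.lead_mul hw

/-- The initial form, as a multiplicative map. -/
noncomputable def initialFormHom (hw : ∀ f, f ≠ 0 → w.toFun f ≠ ⊤) : A →* w.gr :=
  (Ideal.Quotient.mk w.grIdeal : w.rees →* w.gr).comp (w.leadHom hw)

theorem initialForm_algebraMap (c : k) :
    w.initialForm (algebraMap k A c) = algebraMap k w.gr c := by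
  rw [initialForm_eq, lead_algebraMap]
  rfl

theorem initialForm_zero : w.initialForm 0 = 0 := by
  rw [initialForm_eq, lead_zero, _root_.map_zero]

/-- The elements of `G_r` whose class in `G_r / G_{>r} ⊆ gr_w(A)` lies in a given subspace. -/
def classesIn (L : Submodule k w.gr) (r : ℤ) : Submodule k A where
  carrier := {f | ∃ x : w.rees, (x : AddMonoidAlgebra A ℤ) = AddMonoidAlgebra.single r f ∧
    Ideal.Quotient.mk w.grIdeal x ∈ L}
  add_mem' := by
    rintro f g ⟨x, hx, hx'⟩ ⟨y, hy, hy'⟩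
    refine ⟨x + y, ?_, ?_⟩
    · rw [AddMonoidAlgebra.single_add, ← hx, ← hy]
      rfl
    · rw [_root_.map_add]
      exact L.add_mem hx' hy'
  zero_mem' := ⟨0, by simp, by simp⟩
  smul_mem' := by
    rintro c f ⟨x, hx, hx'⟩
    refine ⟨c • x, ?_, L.smul_mem c hx'⟩
    rw [← AddMonoidAlgebra.smul_single, ← hx]
    rfl

theorem Ggt_le_classesIn (L : Submodule k w.gr) (r : ℤ) : w.Ggt r ≤ w.classesIn L r := by
  intro f hf
  have hf' : f ∈ w.G r := le_of_lt (w.mem_Ggt.1 hf)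
  refine ⟨⟨AddMonoidAlgebra.single r f, AddMonoidAlgebra.coeff_single_mem hf'⟩, rfl, ?_⟩
  rw [w.mk_eq_zero_iff.2 (AddMonoidAlgebra.coeff_single_mem hf)]
  exact L.zero_mem

/-- Initial forms are not additive, whereas classes in a fixed `G_r / G_{>r}` are. An element of
value above `r` has class zero there, so sums can be handled in one fixed degree. -/
theorem mem_classesIn_of_initialForm_mem {L : Submodule k w.gr} {f : A}
    (h : w.initialForm f ∈ L) {r : ℤ} (hr : f ∈ w.G r) : f ∈ w.classesIn L r := by
  rcases (w.mem_G.1 hr).lt_or_eq with h1 | h1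
  · exact w.Ggt_le_classesIn L r h1
  · refine ⟨w.lead f, ?_, h⟩
    change AddMonoidAlgebra.single _ _ = _
    rw [← h1]
    rfl

theorem initialForm_mem_of_mem_classesIn {L : Submodule k w.gr} {f : A} {r : ℤ}
    (h : f ∈ w.classesIn L r) (hr : w.toFun f = r) : w.initialForm f ∈ L := by
  obtain ⟨x, hx, hx'⟩ := h
  have : w.lead f = x := by
    apply Subtype.ext
    rw [hx]
    change AddMonoidAlgebra.single _ _ = _
    rw [hr]
    rfl
  rwa [initialForm_eq, this]

/-- The elements of the span of initial forms of elements of `X` have representatives with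
coefficients in `span X`. -/
theorem exists_rep_of_mem_span (X : Set A) {y : w.gr}
    (hy : y ∈ Submodule.span k (w.initialForm '' X)) (Q : ℤ → Submodule k A)
    (hQ : ∀ x ∈ X, x ∈ Q ((w.toFun x).untopD 0)) :
    ∃ x : w.rees, Ideal.Quotient.mk w.grIdeal x = y ∧
      ∀ r, (x : AddMonoidAlgebra A ℤ).coeff r ∈ Q r := by
  induction hy using Submodule.span_induction with
  | mem y hy =>
    obtain ⟨f, hf, rfl⟩ := hy
    exact ⟨w.lead f, rfl, AddMonoidAlgebra.coeff_single_mem (hQ f hf)⟩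
  | zero => exact ⟨0, _root_.map_zero _, fun r => Submodule.zero_mem _⟩
  | add y z _ _ h1 h2 =>
    obtain ⟨a, rfl, ha⟩ := h1
    obtain ⟨b, rfl, hb⟩ := h2
    exact ⟨a + b, _root_.map_add _ _ _, fun r => Submodule.add_mem _ (ha r) (hb r)⟩
  | smul c y _ h1 =>
    obtain ⟨a, rfl, ha⟩ := h1
    exact ⟨c • a, rfl, fun r => Submodule.smul_mem _ c (ha r)⟩

/-- A finite dimensional space is not bigger than a space containing its initial forms. -/
theorem finrank_le_of_initialForm_mem (hw : ∀ f, f ≠ 0 → w.toFun f ≠ ⊤) (E : Submodule k A)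
    (hE : ∃ R : ℤ, ∀ f ∈ E, f ≠ 0 → w.toFun f ≤ R) (L : Submodule k w.gr)
    [FiniteDimensional k L] (hL : ∀ f ∈ E, w.initialForm f ∈ L) :
    Module.finrank k E ≤ Module.finrank k L := by
  classical
  obtain ⟨b, hb, hspan, hli⟩ := exists_linearIndependent k (w.initialForm '' (E : Set A))
  have hbL : Submodule.span k b ≤ L := by
    rw [hspan, Submodule.span_le]
    rintro _ ⟨f, hf, rfl⟩
    exact hL f hf
  have : FiniteDimensional k (Submodule.span k b) := Submodule.finiteDimensional_of_le hbL
  have hbfin : b.Finite := by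
    have h : LinearIndependent k
        (fun y : b => (⟨y, hbL (Submodule.subset_span y.2)⟩ : L)) :=
      LinearIndependent.of_comp L.subtype hli
    have := h.finite
    exact Set.toFinite b
  have : Fintype b := hbfin.fintype
  choose! f hfE hf using hb
  have hUE : Submodule.span k (f '' b) ≤ E := by
    rw [Submodule.span_le]
    rintro _ ⟨y, hy, rfl⟩
    exact hfE hy
  have himg : w.initialForm '' (f '' b) = b := by
    rw [Set.image_image]
    exact (Set.image_congr fun y hy => hf hy).trans (Set.image_id' b)
  have hEU : E ≤ Submodule.span k (f '' b) := by
    by_contra hcon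
    obtain ⟨g, hgE, hgU⟩ := Set.not_subset.1 hcon
    obtain ⟨R, hR⟩ := hE
    have hfin : ∀ g, g ∉ Submodule.span k (f '' b) → g ≠ 0 := fun g hg h0 =>
      hg (h0 ▸ Submodule.zero_mem _)
    -- Take `g ∈ E` outside the span with the largest possible value. Subtracting a combination with
    -- the same initial form stays in `E` and outside the span, but raises the value.
    obtain ⟨r, ⟨g, hgE, hgU, hgr⟩, hmax⟩ := Int.exists_greatest_of_bdd
      (P := fun r => ∃ g ∈ E, g ∉ Submodule.span k (f '' b) ∧ w.toFun g = r)
      ⟨R, by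
        rintro r ⟨g, hgE, hgU, hgr⟩
        have := hR g hgE (hfin g hgU)
        rw [hgr] at this
        exact WithTop.coe_le_coe.1 this⟩
      ⟨_, g, hgE, hgU, (w.untopD_coe (hw g (hfin g hgU))).symm⟩
    have h1 : w.initialForm g ∈ Submodule.span k (w.initialForm '' (f '' b)) := by
      rw [himg, hspan]
      exact Submodule.subset_span ⟨g, hgE, rfl⟩
    obtain ⟨x, hx, hxU⟩ := w.exists_rep_of_mem_span _ h1
      (fun _ => Submodule.span k (f '' b)) (fun x hx => Submodule.subset_span hx)
    rw [initialForm_eq, eq_comm, mk_eq_mk_iff] at hx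
    have h2 := hx r
    have h3 : (w.lead g : AddMonoidAlgebra A ℤ).coeff r = g := by
      change (AddMonoidAlgebra.single _ _).coeff r = g
      rw [hgr, AddMonoidAlgebra.coeff_single]
      simp
    rw [h3] at h2
    set u := (x : AddMonoidAlgebra A ℤ).coeff r
    have h4 : g - u ∉ Submodule.span k (f '' b) := fun h =>
      hgU ((Submodule.sub_mem_iff_left _ (hxU r)).1 h)
    have h5 := hmax _ ⟨g - u, Submodule.sub_mem _ hgE (hUE (hxU r)), h4,
      (w.untopD_coe (hw _ (hfin _ h4))).symm⟩
    have h6 := w.mem_Ggt.1 h2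
    rw [← w.untopD_coe (hw _ (hfin _ h4)), WithTop.coe_lt_coe] at h6
    omega
  have hfinU : Module.Finite k (Submodule.span k (f '' b)) :=
    FiniteDimensional.span_of_finite k (hbfin.image f)
  calc Module.finrank k E ≤ Module.finrank k (Submodule.span k (f '' b)) :=
        Submodule.finrank_mono hEU
    _ ≤ (f '' b).toFinset.card := finrank_span_le_card _
    _ ≤ b.toFinset.card := by
        rw [Set.toFinset_image]
        exact Finset.card_image_le
    _ = Module.finrank k (Submodule.span k b) := (finrank_span_set_eq_card hli).symm
    _ ≤ Module.finrank k L := Submodule.finrank_mono hbL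

end Initial

/-! ### Initial forms and the grading -/

section Graded

variable {k A : Type*} [Field k] [CommRing A] [Algebra k A] (w : IntValuation k A)
  (𝒜 : ℕ → Submodule k A) [GradedAlgebra 𝒜]

/-- Homogeneity of the valuation puts all components of `f` in `G_r` for `r = w(f)`, so the class of
`f` is the sum of their classes, each being an initial form or zero. -/
theorem initialForm_mem_of_components
    (hgr : ∀ f n, w.toFun f ≤ w.toFun (DirectSum.decompose 𝒜 f n : A))
    {L : Submodule k w.gr} {f : A} (hf : w.toFun f ≠ ⊤)
    (h : ∀ n, w.initialForm (DirectSum.decompose 𝒜 f n : A) ∈ L) : w.initialForm f ∈ L := by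
  classical
  refine w.initialForm_mem_of_mem_classesIn (r := (w.toFun f).untopD 0) ?_ (w.untopD_coe hf).symm
  suffices hsum : ∑ n ∈ (DirectSum.decompose 𝒜 f).support, (DirectSum.decompose 𝒜 f n : A) ∈
      w.classesIn L ((w.toFun f).untopD 0) by
    rwa [DirectSum.sum_support_decompose 𝒜 f] at hsum
  refine Submodule.sum_mem _ fun n _ => w.mem_classesIn_of_initialForm_mem (h n) ?_
  rw [mem_G, w.untopD_coe hf]
  exact hgr f n

/-- If the initial forms of a set of homogeneous elements generate the associated graded algebra,
then initial forms of homogeneous elements of degree `m` are combinations of initial forms of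
monomials of degree `m`. -/
theorem initialForm_mem_span_of_mem_degree (hw : ∀ f, f ≠ 0 → w.toFun f ≠ ⊤)
    (hgr : ∀ f n, w.toFun f ≤ w.toFun (DirectSum.decompose 𝒜 f n : A))
    {H : Set A} (hH : ∀ h ∈ H, ∃ n, h ∈ 𝒜 n) (hgen : Algebra.adjoin k (w.initialForm '' H) = ⊤)
    {m : ℕ} {f : A} (hf : f ∈ 𝒜 m) :
    w.initialForm f ∈
      Submodule.span k (w.initialForm '' {x | x ∈ Submonoid.closure H ∧ x ∈ 𝒜 m}) := by
  classical
  by_cases hf0 : f = 0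
  · rw [hf0, initialForm_zero]
    exact Submodule.zero_mem _
  set L := Submodule.span k (w.initialForm '' {x | x ∈ Submonoid.closure H ∧ x ∈ 𝒜 m})
  have hmem : w.initialForm f ∈
      Submodule.span k (w.initialForm '' (Submonoid.closure H : Set A)) := by
    have h1 : w.initialForm f ∈ Algebra.adjoin k (w.initialForm '' H) := hgen ▸ Algebra.mem_top
    rw [← Subalgebra.mem_toSubmodule, Algebra.adjoin_eq_span] at h1
    have h2 := MonoidHom.map_mclosure (w.initialFormHom hw) H
    have h3 : w.initialForm '' (Submonoid.closure H : Set A) =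
        (Submonoid.closure (w.initialForm '' H) : Set w.gr) := congrArg SetLike.coe h2
    rwa [h3]
  have hhom : ∀ x ∈ Submonoid.closure H, ∃ n, x ∈ 𝒜 n := by
    intro x hx
    induction hx using Submonoid.closure_induction with
    | mem x hx => exact hH x hx
    | one => exact ⟨0, SetLike.GradedOne.one_mem⟩
    | mul x y _ _ h1 h2 =>
      obtain ⟨a, ha⟩ := h1
      obtain ⟨b, hb⟩ := h2
      exact ⟨a + b, SetLike.GradedMul.mul_mem ha hb⟩
  -- The condition on representatives constrains only their degree `m` component: monomials of
  -- another degree project to zero, and those of degree `m` have initial form in `L`.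
  obtain ⟨x, hx, hxQ⟩ := w.exists_rep_of_mem_span _ hmem
    (fun r => (w.classesIn L r).comap (GradedAlgebra.proj 𝒜 m)) (fun x hx => by
      rw [Submodule.mem_comap, GradedAlgebra.proj_apply]
      by_cases hx0 : x = 0
      · simp [hx0]
      obtain ⟨n, hn⟩ := hhom x hx
      by_cases hnm : n = m
      · subst hnm
        rw [DirectSum.decompose_of_mem_same 𝒜 hn]
        have hxL : w.initialForm x ∈ L := Submodule.subset_span ⟨x, ⟨hx, hn⟩, rfl⟩
        refine w.mem_classesIn_of_initialForm_mem hxL ?_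
        rw [mem_G, w.untopD_coe (hw x hx0)]
      · rw [DirectSum.decompose_of_mem_ne 𝒜 hn hnm]
        exact Submodule.zero_mem _)
  refine w.initialForm_mem_of_mem_classesIn (r := (w.toFun f).untopD 0) ?_
    (w.untopD_coe (hw f hf0)).symm
  set r := (w.toFun f).untopD 0
  rw [initialForm_eq, eq_comm, mk_eq_mk_iff] at hx
  have h1 := hx r
  have h2 : (w.lead f : AddMonoidAlgebra A ℤ).coeff r = f := by
    change (AddMonoidAlgebra.single r f).coeff r = f
    rw [AddMonoidAlgebra.coeff_single, Finsupp.single_eq_same]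
  rw [h2] at h1
  -- Projection to degree `m` does not lower values, so the error term remains negligible.
  have h3 : GradedAlgebra.proj 𝒜 m (f - (x : AddMonoidAlgebra A ℤ).coeff r) ∈ w.Ggt r := by
    rw [GradedAlgebra.proj_apply]
    exact lt_of_lt_of_le (w.mem_Ggt.1 h1) (hgr _ m)
  rw [_root_.map_sub, GradedAlgebra.proj_apply, DirectSum.decompose_of_mem_same 𝒜 hf] at h3
  have h4 : GradedAlgebra.proj 𝒜 m ((x : AddMonoidAlgebra A ℤ).coeff r) ∈ w.classesIn L r := hxQ r
  exact (Submodule.sub_mem_iff_left _ h4).1 (w.Ggt_le_classesIn L r h3)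

end Graded

end IntValuation

/-! ## Truncations of a graded algebra -/

/-- The sum of the graded pieces of degree at most `J`. -/
def degreeLE {k A : Type*} [Field k] [CommRing A] [Algebra k A] (𝒜 : ℕ → Submodule k A) (J : ℕ) :
    Submodule k A :=
  ⨆ n : Fin (J + 1), 𝒜 n

namespace degreeLE

variable {k A : Type*} [Field k] [CommRing A] [Algebra k A] (𝒜 : ℕ → Submodule k A)

instance finiteDimensional [∀ n, FiniteDimensional k (𝒜 n)] (J : ℕ) :
    FiniteDimensional k (degreeLE 𝒜 J) :=
  Submodule.finite_iSup _

theorem le_degreeLE {n J : ℕ} (h : n ≤ J) : 𝒜 n ≤ degreeLE 𝒜 J :=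
  le_iSup (fun n : Fin (J + 1) => 𝒜 n) ⟨n, by omega⟩

theorem mono {I J : ℕ} (h : I ≤ J) : degreeLE 𝒜 I ≤ degreeLE 𝒜 J :=
  iSup_le fun n => le_degreeLE 𝒜 (by omega)

variable [GradedAlgebra 𝒜]

theorem mul_mem {I J : ℕ} {f g : A} (hf : f ∈ degreeLE 𝒜 I) (hg : g ∈ degreeLE 𝒜 J) :
    f * g ∈ degreeLE 𝒜 (I + J) := by
  have h : degreeLE 𝒜 I * degreeLE 𝒜 J ≤ degreeLE 𝒜 (I + J) := by
    unfold degreeLE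
    rw [Submodule.iSup_mul]
    refine iSup_le fun a => ?_
    rw [Submodule.mul_iSup]
    refine iSup_le fun b => Submodule.mul_le.2 fun x hx y hy => ?_
    exact le_degreeLE 𝒜 (by omega) (SetLike.GradedMul.mul_mem hx hy)
  exact h (Submodule.mul_mem_mul hf hg)

theorem decompose_eq_zero {J n : ℕ} {f : A} (hf : f ∈ degreeLE 𝒜 J) (hn : J < n) :
    (DirectSum.decompose 𝒜 f n : A) = 0 := by
  have h : degreeLE 𝒜 J ≤ LinearMap.ker (GradedAlgebra.proj 𝒜 n) := by
    refine iSup_le fun m x hx => ?_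
    rw [LinearMap.mem_ker, GradedAlgebra.proj_apply]
    exact DirectSum.decompose_of_mem_ne 𝒜 hx (by omega)
  simpa [GradedAlgebra.proj_apply] using h hf

theorem exists_mem (f : A) : ∃ J, f ∈ degreeLE 𝒜 J := by
  classical
  refine ⟨(DirectSum.decompose 𝒜 f).support.sup id, ?_⟩
  suffices h : ∑ n ∈ (DirectSum.decompose 𝒜 f).support, (DirectSum.decompose 𝒜 f n : A) ∈
      degreeLE 𝒜 ((DirectSum.decompose 𝒜 f).support.sup id) by
    rwa [DirectSum.sum_support_decompose 𝒜 f] at h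
  exact Submodule.sum_mem _ fun n hn =>
    le_degreeLE 𝒜 (Finset.le_sup (f := id) hn) (SetLike.coe_mem _)

end degreeLE

/-- In a graded domain with finite dimensional pieces over an algebraically closed field, the
elements of degree zero are constants. -/
theorem exists_algebraMap_eq_of_mem_degree_zero {k A : Type*} [Field k] [IsAlgClosed k]
    [CommRing A] [IsDomain A] [Algebra k A] (𝒜 : ℕ → Submodule k A) [GradedAlgebra 𝒜]
    [FiniteDimensional k (𝒜 0)] {f : A} (hf : f ∈ 𝒜 0) : ∃ c : k, algebraMap k A c = f := by
  have hint : IsIntegral k f := by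
    let S : Subalgebra k A := SetLike.GradeZero.subalgebra 𝒜
    have : FiniteDimensional k (Subalgebra.toSubmodule S) := ‹FiniteDimensional k (𝒜 0)›
    have : Module.Finite k S := this
    exact (Algebra.IsIntegral.isIntegral (R := k) (⟨f, hf⟩ : S)).map S.val
  have h1 := IsAlgClosed.degree_eq_one_of_irreducible k (minpoly.irreducible hint)
  obtain ⟨c, hc⟩ := minpoly.mem_range_of_degree_eq_one k f h1
  exact ⟨c, hc⟩

/-! ## Growth of the associated graded algebra -/

namespace IntValuation

section Growth

variable {k A : Type*} [Field k] [CommRing A] [Algebra k A] (w : IntValuation k A) (B : Set A)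

/-- The map `k[Y] → ⨁ G_r`, `Y_b ↦ b t^{w(b)}`. -/
noncomputable def leadMap : MvPolynomial B k →ₐ[k] w.rees :=
  MvPolynomial.aeval fun b => w.lead b

/-- The map `k[Y] → gr_w(A)` which sends `Y_b` to the initial form of `b`. -/
noncomputable def initialMap : MvPolynomial B k →ₐ[k] w.gr :=
  (Ideal.Quotient.mkₐ k w.grIdeal).comp (w.leadMap B)

theorem initialMap_X (b : B) : w.initialMap B (MvPolynomial.X b) = w.initialForm b := by
  change Ideal.Quotient.mk _ (w.leadMap B (MvPolynomial.X b)) = _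
  rw [leadMap, MvPolynomial.aeval_X, initialForm_eq]

theorem initialMap_eq_zero_iff {p : MvPolynomial B k} : w.initialMap B p = 0 ↔
    ∀ r, (w.leadMap B p : AddMonoidAlgebra A ℤ).coeff r ∈ w.Ggt r :=
  w.mk_eq_zero_iff

theorem initialMap_surjective (hK : w.IsKhovanskiiBasis B) :
    Function.Surjective (w.initialMap B) := by
  rw [← AlgHom.range_eq_top, eq_top_iff, ← hK, Algebra.adjoin_le_iff]
  rintro _ ⟨b, hb, rfl⟩
  exact ⟨MvPolynomial.X ⟨b, hb⟩, w.initialMap_X B ⟨b, hb⟩⟩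

/-- The nonzero homogeneous components of positive degree of the elements of `B`. -/
def positiveComponents (𝒜 : ℕ → Submodule k A) [GradedAlgebra 𝒜] (B : Set A) : Set A :=
  {h | ∃ b ∈ B, ∃ n, 1 ≤ n ∧ (DirectSum.decompose 𝒜 b n : A) ≠ 0 ∧
    h = (DirectSum.decompose 𝒜 b n : A)}

theorem positiveComponents_finite (𝒜 : ℕ → Submodule k A) [GradedAlgebra 𝒜] {B : Set A}
    (hB : B.Finite) : (positiveComponents 𝒜 B).Finite := by
  classical
  refine (hB.biUnion fun b _ => ((DirectSum.decompose 𝒜 b).support.finite_toSet.image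
    fun n => (DirectSum.decompose 𝒜 b n : A))).subset ?_
  rintro _ ⟨b, hb, n, -, hn, rfl⟩
  refine Set.mem_biUnion hb ⟨n, ?_, rfl⟩
  rw [Finset.mem_coe, DFinsupp.mem_support_iff]
  intro h
  exact hn (by rw [h]; rfl)

/-- Elements of `B` need not be homogeneous, but their initial forms are sums of classes of their
components. Degree zero components are constants and can be dropped, which leaves generators of
degree at least 1. -/
theorem adjoin_initialForm_positiveComponents [IsAlgClosed k] [IsDomain A]
    (𝒜 : ℕ → Submodule k A) [GradedAlgebra 𝒜] [FiniteDimensional k (𝒜 0)]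
    (hw : ∀ f, f ≠ 0 → w.toFun f ≠ ⊤)
    (hgr : ∀ f n, w.toFun f ≤ w.toFun (DirectSum.decompose 𝒜 f n : A))
    (hK : w.IsKhovanskiiBasis B) :
    Algebra.adjoin k (w.initialForm '' positiveComponents 𝒜 B) = ⊤ := by
  rw [eq_top_iff, ← hK, Algebra.adjoin_le_iff]
  rintro _ ⟨b, hb, rfl⟩
  set S := Algebra.adjoin k (w.initialForm '' positiveComponents 𝒜 B)
  by_cases hb0 : b = 0
  · rw [hb0, initialForm_zero]
    exact S.zero_mem
  refine w.initialForm_mem_of_components 𝒜 hgr (L := Subalgebra.toSubmodule S) (hw b hb0)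
    fun n => ?_
  rw [Subalgebra.mem_toSubmodule]
  rcases Nat.eq_zero_or_pos n with rfl | hn
  · obtain ⟨c, hc⟩ := exists_algebraMap_eq_of_mem_degree_zero 𝒜
      (SetLike.coe_mem (DirectSum.decompose 𝒜 b 0))
    rw [← hc, initialForm_algebraMap]
    exact S.algebraMap_mem c
  · by_cases h0 : (DirectSum.decompose 𝒜 b n : A) = 0
    · rw [h0, initialForm_zero]
      exact S.zero_mem
    · exact Algebra.subset_adjoin ⟨_, ⟨b, hb, n, hn, h0, rfl⟩, rfl⟩

/-- The initial forms of elements of degree at most `J` are images of polynomials whose degree is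
bounded linearly in `J`. -/
theorem exists_initialForm_mem_map [IsAlgClosed k]
    (𝒜 : ℕ → Submodule k A) [GradedAlgebra 𝒜] [FiniteDimensional k (𝒜 0)]
    (hw : ∀ f, f ≠ 0 → w.toFun f ≠ ⊤)
    (hgr : ∀ f n, w.toFun f ≤ w.toFun (DirectSum.decompose 𝒜 f n : A))
    (hB : B.Finite) (hK : w.IsKhovanskiiBasis B) :
    ∃ c, ∀ J, ∀ f ∈ degreeLE 𝒜 J, w.initialForm f ∈
      (MvPolynomial.restrictTotalDegree B k (c * J)).map (w.initialMap B).toLinearMap := by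
  have := w.isDomain hw
  set H := positiveComponents 𝒜 B
  have hHfin : H.Finite := positiveComponents_finite 𝒜 hB
  choose p hp using fun h : A => w.initialMap_surjective B hK (w.initialForm h)
  set c := hHfin.toFinset.sup fun h => (p h).totalDegree
  refine ⟨c, fun J f hf => ?_⟩
  by_cases hf0 : f = 0
  · rw [hf0, initialForm_zero]
    exact Submodule.zero_mem _
  -- Each factor costs polynomial degree at most `c` and contributes degree at least 1 in `A`, so a
  -- product of degree `n` costs at most `c * n`.
  have hclosure : ∀ x ∈ Submonoid.closure H, ∃ n, x ∈ 𝒜 n ∧ ∃ q : MvPolynomial B k,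
      q.totalDegree ≤ c * n ∧ w.initialMap B q = w.initialForm x := by
    intro x hx
    induction hx using Submonoid.closure_induction with
    | mem x hx =>
      have h1 : (p x).totalDegree ≤ c :=
        Finset.le_sup (f := fun h => (p h).totalDegree) (hHfin.mem_toFinset.2 hx)
      obtain ⟨b, hb, n, hn, h0, rfl⟩ := hx
      exact ⟨n, SetLike.coe_mem _, p _, h1.trans (Nat.le_mul_of_pos_right c hn), hp _⟩
    | one =>
      exact ⟨0, SetLike.GradedOne.one_mem, 1, by simp, by
        rw [_root_.map_one]
        exact ((w.initialFormHom hw).map_one).symm⟩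
    | mul x y _ _ h1 h2 =>
      obtain ⟨m, hm, q, hq, hqx⟩ := h1
      obtain ⟨n, hn, q', hq', hqy⟩ := h2
      refine ⟨m + n, SetLike.GradedMul.mul_mem hm hn, q * q', ?_, ?_⟩
      · refine (MvPolynomial.totalDegree_mul q q').trans ?_
        rw [mul_add]
        exact add_le_add hq hq'
      · rw [_root_.map_mul, hqx, hqy]
        exact ((w.initialFormHom hw).map_mul x y).symm
  refine w.initialForm_mem_of_components 𝒜 hgr (hw f hf0) fun n => ?_
  by_cases hn : J < n
  · rw [degreeLE.decompose_eq_zero 𝒜 hf hn, initialForm_zero]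
    exact Submodule.zero_mem _
  refine Submodule.span_le.2 ?_ (w.initialForm_mem_span_of_mem_degree 𝒜 hw hgr (H := H) ?_
    (w.adjoin_initialForm_positiveComponents B 𝒜 hw hgr hK)
    (SetLike.coe_mem (DirectSum.decompose 𝒜 f n)))
  · rintro _ ⟨x, ⟨hx, hxn⟩, rfl⟩
    by_cases hx0 : x = 0
    · rw [hx0, initialForm_zero]
      exact Submodule.zero_mem _
    obtain ⟨m, hm, q, hq, hqx⟩ := hclosure x hx
    obtain rfl : m = n := DirectSum.degree_eq_of_mem_mem 𝒜 hm hxn hx0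
    refine ⟨q, ?_, hqx⟩
    rw [SetLike.mem_coe, MvPolynomial.mem_restrictTotalDegree]
    exact hq.trans (Nat.mul_le_mul_left c (by omega))
  · rintro _ ⟨b, hb, n, hn, h0, rfl⟩
    exact ⟨n, SetLike.coe_mem _⟩

end Growth

end IntValuation

/-! ## The filtration defined by a generating set -/

namespace IntValuation

variable {k A : Type*} [Field k] [CommRing A] [Algebra k A] (w : IntValuation k A) (B : Set A)

/-- The span of the monomials in the elements of `B` whose value is at least `r`. -/
def monomialFiltration (r : ℤ) : Submodule k A :=
  Submodule.span k {x | x ∈ Submonoid.closure B ∧ (r : WithTop ℤ) ≤ w.toFun x}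

theorem mem_monomialFiltration {r : ℤ} {x : A} (hx : x ∈ Submonoid.closure B)
    (hr : (r : WithTop ℤ) ≤ w.toFun x) : x ∈ w.monomialFiltration B r :=
  Submodule.subset_span ⟨hx, hr⟩

theorem monomialFiltration_le_G (r : ℤ) : w.monomialFiltration B r ≤ w.G r :=
  Submodule.span_le.2 fun _ hx => hx.2

theorem monomialFiltration_antitone : Antitone (w.monomialFiltration B) := fun _ _ h =>
  Submodule.span_mono fun _ hx => ⟨hx.1, (WithTop.coe_le_coe.2 h).trans hx.2⟩

theorem mul_mem_monomialFiltration {r s : ℤ} {f g : A} (hf : f ∈ w.monomialFiltration B r)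
    (hg : g ∈ w.monomialFiltration B s) : f * g ∈ w.monomialFiltration B (r + s) := by
  have h : w.monomialFiltration B r * w.monomialFiltration B s ≤
      w.monomialFiltration B (r + s) := by
    unfold monomialFiltration
    rw [Submodule.span_mul_span, Submodule.span_le]
    rintro _ ⟨x, hx, y, hy, rfl⟩
    exact w.mem_monomialFiltration B (mul_mem hx.1 hy.1) (w.mul_mem_G hx.2 hy.2)
  exact h (Submodule.mul_mem_mul hf hg)

theorem one_mem_monomialFiltration : (1 : A) ∈ w.monomialFiltration B 0 :=
  w.mem_monomialFiltration B (one_mem _) (by simp [w.map_one])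

variable {B} in
theorem leadMap_coeff_mem (hw : ∀ f, f ≠ 0 → w.toFun f ≠ ⊤) (h0 : (0 : A) ∉ B)
    (p : MvPolynomial B k) (r : ℤ) :
    (w.leadMap B p : AddMonoidAlgebra A ℤ).coeff r ∈ w.monomialFiltration B r := by
  have h : ∀ p, w.leadMap B p ∈ (gradedSubalgebra (w.monomialFiltration B)
      (w.one_mem_monomialFiltration B)
      (fun _ _ _ _ => w.mul_mem_monomialFiltration B)).comap w.rees.val := by
    intro p
    induction p using MvPolynomial.induction_on with
    | C c =>
      rw [← MvPolynomial.algebraMap_eq, AlgHom.commutes]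
      exact Subalgebra.algebraMap_mem _ c
    | add p q hp hq =>
      rw [_root_.map_add]
      exact add_mem hp hq
    | mul_X p b hp =>
      rw [_root_.map_mul]
      refine mul_mem hp ?_
      rw [leadMap, MvPolynomial.aeval_X]
      refine AddMonoidAlgebra.coeff_single_mem ?_
      refine w.mem_monomialFiltration B (Submonoid.subset_closure b.2) ?_
      rw [w.untopD_coe (hw _ fun h => h0 (h ▸ b.2))]
  exact h p r

variable {B} in
/-- The kernel of the map from `k[Y]` to the graded algebra of the filtration by monomials. -/
noncomputable def monomialIdeal (hw : ∀ f, f ≠ 0 → w.toFun f ≠ ⊤) (h0 : (0 : A) ∉ B) :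
    Ideal (MvPolynomial B k) where
  carrier := {p | ∀ r, (w.leadMap B p : AddMonoidAlgebra A ℤ).coeff r ∈
    w.monomialFiltration B (r + 1)}
  add_mem' := fun {p q} hp hq r => by
    rw [_root_.map_add]
    exact Submodule.add_mem _ (hp r) (hq r)
  zero_mem' := fun r => by
    rw [_root_.map_zero]
    exact Submodule.zero_mem _
  smul_mem' := fun c p hp r => by
    rw [smul_eq_mul, _root_.map_mul]
    refine AddMonoidAlgebra.coeff_mul_mem (P := w.monomialFiltration B)
      (Q := fun r => w.monomialFiltration B (r + 1)) (H := fun r => w.monomialFiltration B (r + 1))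
      (fun p q a ha b hb => ?_) (w.leadMap_coeff_mem hw h0 c) hp r
    rw [add_assoc]
    exact w.mul_mem_monomialFiltration B ha hb

variable {B} in
theorem monomialIdeal_le_ker (hw : ∀ f, f ≠ 0 → w.toFun f ≠ ⊤) (h0 : (0 : A) ∉ B) :
    w.monomialIdeal hw h0 ≤ RingHom.ker (w.initialMap B) := by
  intro p hp
  rw [RingHom.mem_ker, initialMap_eq_zero_iff]
  intro r
  rw [mem_Ggt_iff_mem_G]
  exact w.monomialFiltration_le_G B _ (hp r)

-- Modulo this ideal `k[Y]` embeds in the graded algebra of the monomial filtration, so primality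
-- can be tested on homogeneous elements. The ideal is proper since 1 survives in `gr_w(A)`.
variable {B} in
theorem monomialIdeal_isPrime (hw : ∀ f, f ≠ 0 → w.toFun f ≠ ⊤) (h0 : (0 : A) ∉ B)
    (hprime : ∀ r s, ∀ f ∈ w.monomialFiltration B r, ∀ g ∈ w.monomialFiltration B s,
      f * g ∈ w.monomialFiltration B (r + s + 1) →
        f ∈ w.monomialFiltration B (r + 1) ∨ g ∈ w.monomialFiltration B (s + 1)) :
    (w.monomialIdeal hw h0).IsPrime := by
  refine ⟨fun htop => ?_, fun {p q} hpq => ?_⟩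
  · have h1 : (1 : MvPolynomial B k) ∈ RingHom.ker (w.initialMap B) :=
      w.monomialIdeal_le_ker hw h0 (htop ▸ Submodule.mem_top)
    rw [RingHom.mem_ker, initialMap_eq_zero_iff] at h1
    have h2 := h1 0
    rw [_root_.map_one] at h2
    change (1 : AddMonoidAlgebra A ℤ).coeff 0 ∈ _ at h2
    rw [AddMonoidAlgebra.one_def, AddMonoidAlgebra.coeff_single, Finsupp.single_eq_same, mem_Ggt,
      w.map_one] at h2
    exact lt_irrefl _ h2
  · refine AddMonoidAlgebra.coeff_mem_or_coeff_mem_of_mul (P := w.monomialFiltration B)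
      (Q := fun r => w.monomialFiltration B (r + 1)) (fun p q a ha b hb => ?_) hprime
      (w.leadMap_coeff_mem hw h0 p) (w.leadMap_coeff_mem hw h0 q) (fun r => ?_)
    · rw [add_assoc]
      exact w.mul_mem_monomialFiltration B ha hb
    · have := hpq r
      rwa [_root_.map_mul] at this

/-! ### Comparison of dimensions for the monomial filtration -/

variable {B} in
theorem exists_monomial_image (hw : ∀ f, f ≠ 0 → w.toFun f ≠ ⊤) (h0 : (0 : A) ∉ B)
    (𝒜 : ℕ → Submodule k A) [GradedAlgebra 𝒜] {D : ℕ} (hD : ∀ b ∈ B, b ∈ degreeLE 𝒜 D)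
    (a : B →₀ ℕ) : ∃ x ∈ Submonoid.closure B, x ≠ 0 ∧ x ∈ degreeLE 𝒜 (D * a.degree) ∧
      w.leadMap B (MvPolynomial.monomial a 1) = w.lead x := by
  have := w.isDomain hw
  have hone : ∃ x ∈ Submonoid.closure B, x ≠ 0 ∧ x ∈ degreeLE 𝒜 (D * (0 : B →₀ ℕ).degree) ∧
      w.leadMap B (MvPolynomial.monomial (0 : B →₀ ℕ) 1) = w.lead x := by
    refine ⟨1, one_mem _, one_ne_zero,
      degreeLE.le_degreeLE 𝒜 (Nat.zero_le _) SetLike.GradedOne.one_mem, ?_⟩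
    rw [lead_one, ← MvPolynomial.C_apply, MvPolynomial.C_1, _root_.map_one]
  have hadd : ∀ a b : B →₀ ℕ, (∃ x ∈ Submonoid.closure B, x ≠ 0 ∧
      x ∈ degreeLE 𝒜 (D * a.degree) ∧ w.leadMap B (MvPolynomial.monomial a 1) = w.lead x) →
      (∃ x ∈ Submonoid.closure B, x ≠ 0 ∧
      x ∈ degreeLE 𝒜 (D * b.degree) ∧ w.leadMap B (MvPolynomial.monomial b 1) = w.lead x) →
      ∃ x ∈ Submonoid.closure B, x ≠ 0 ∧ x ∈ degreeLE 𝒜 (D * (a + b).degree) ∧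
        w.leadMap B (MvPolynomial.monomial (a + b) 1) = w.lead x := by
    rintro a b ⟨x, hx, hx0, hxD, hxl⟩ ⟨y, hy, hy0, hyD, hyl⟩
    refine ⟨x * y, mul_mem hx hy, mul_ne_zero hx0 hy0, ?_, ?_⟩
    · rw [_root_.map_add, mul_add]
      exact degreeLE.mul_mem 𝒜 hxD hyD
    · rw [w.lead_mul hw, ← hxl, ← hyl, ← _root_.map_mul, MvPolynomial.monomial_mul, one_mul]
  induction a using Finsupp.induction_linear with
  | zero => exact hone
  | add a b ha hb => exact hadd a b ha hb
  | single b n =>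
    induction n with
    | zero => simpa using hone
    | succ n ih =>
      rw [Finsupp.single_add]
      refine hadd _ _ ih ⟨b, Submonoid.subset_closure b.2, fun h => h0 (h ▸ b.2), ?_, ?_⟩
      · simpa using hD b b.2
      · exact MvPolynomial.aeval_X _ b

variable {B} in
/-- The dimension of the classes of polynomials of degree at most `M` is at most the dimension of
the part of `A` of degree at most `D M`. -/
theorem finrank_map_mk_le (hw : ∀ f, f ≠ 0 → w.toFun f ≠ ⊤) (h0 : (0 : A) ∉ B)
    (𝒜 : ℕ → Submodule k A) [GradedAlgebra 𝒜] [∀ n, FiniteDimensional k (𝒜 n)]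
    {D : ℕ} (hD : ∀ b ∈ B, b ∈ degreeLE 𝒜 D) (M : ℕ) :
    Module.finrank k ((MvPolynomial.restrictTotalDegree B k M).map
      (Ideal.Quotient.mkₐ k (w.monomialIdeal hw h0)).toLinearMap) ≤
        Module.finrank k (degreeLE 𝒜 (D * M)) := by
  classical
  set q := (Ideal.Quotient.mkₐ k (w.monomialIdeal hw h0)).toLinearMap
  rw [MvPolynomial.restrictTotalDegree_eq_span, Submodule.map_span, Set.image_image]
  obtain ⟨Y, hY, hspan, hli⟩ := exists_linearIndependent k
    ((fun a => q (MvPolynomial.monomial a (1 : k))) '' {a : B →₀ ℕ | a.degree ≤ M})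
  rw [← hspan]
  choose a haM haY using fun y : Y => hY y.2
  choose x hx hx0 hxD hxl using fun y : Y => w.exists_monomial_image hw h0 𝒜 hD (a y)
  have hxM : ∀ y, x y ∈ degreeLE 𝒜 (D * M) := fun y =>
    degreeLE.mono 𝒜 (Nat.mul_le_mul_left D (haM y)) (hxD y)
  -- In a relation among the `x y`, the terms of least value sum to minus the terms of higher value,
  -- so their sum is in the next filtration step. The corresponding relation among polynomials
  -- therefore holds modulo `monomialIdeal`, against the independence of the chosen classes.
  have hxli : LinearIndependent k x := by
    rw [linearIndependent_iff']
    intro s c hc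
    by_contra! hcon
    obtain ⟨y₀, hy₀, hcy₀⟩ := hcon
    set e : Y → ℤ := fun y => (w.toFun (x y)).untopD 0
    obtain ⟨y₁, hy₁, hmin⟩ := Finset.exists_min_image (s.filter fun y => c y ≠ 0) e
      ⟨y₀, Finset.mem_filter.2 ⟨hy₀, hcy₀⟩⟩
    set s₁ := s.filter fun y => e y = e y₁
    rw [Finset.mem_filter] at hy₁
    have hP : ∑ y ∈ s₁, c y • MvPolynomial.monomial (a y) (1 : k) ∈ w.monomialIdeal hw h0 := by
      have h1 : (w.leadMap B (∑ y ∈ s₁, c y • MvPolynomial.monomial (a y) (1 : k)) :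
          AddMonoidAlgebra A ℤ) = AddMonoidAlgebra.single (e y₁) (∑ y ∈ s₁, c y • x y) := by
        rw [map_sum, AddSubmonoidClass.coe_finsetSum]
        rw [← AddMonoidAlgebra.singleAddHom_apply, map_sum]
        refine Finset.sum_congr rfl fun y hy => ?_
        rw [map_smul, hxl, AddMonoidAlgebra.singleAddHom_apply, ← AddMonoidAlgebra.smul_single,
          ← (Finset.mem_filter.1 hy).2]
        rfl
      have h2 : ∑ y ∈ s₁, c y • x y ∈ w.monomialFiltration B (e y₁ + 1) := by
        rw [← Finset.sum_filter_add_sum_filter_not s (fun y => e y = e y₁)] at hc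
        rw [eq_neg_of_add_eq_zero_left hc]
        refine Submodule.neg_mem _ (Submodule.sum_mem _ fun y hy => ?_)
        rw [Finset.mem_filter] at hy
        by_cases hcy : c y = 0
        · rw [hcy, zero_smul]
          exact Submodule.zero_mem _
        refine Submodule.smul_mem _ _ (w.mem_monomialFiltration B (hx y) ?_)
        rw [← w.untopD_coe (hw _ (hx0 y)), WithTop.coe_le_coe]
        have := hmin y (Finset.mem_filter.2 ⟨hy.1, hcy⟩)
        have h3 : e y ≠ e y₁ := hy.2
        change e y₁ + 1 ≤ e y
        omega
      intro r
      rw [h1]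
      exact AddMonoidAlgebra.coeff_single_mem (P := fun r => w.monomialFiltration B (r + 1)) h2 r
    have h4 : ∑ y ∈ s₁, c y • (y : MvPolynomial B k ⧸ w.monomialIdeal hw h0) = 0 := by
      have h5 : q (∑ y ∈ s₁, c y • MvPolynomial.monomial (a y) (1 : k)) = 0 :=
        Ideal.Quotient.eq_zero_iff_mem.2 hP
      rw [map_sum] at h5
      rw [← h5]
      refine Finset.sum_congr rfl fun y _ => ?_
      rw [map_smul]
      exact congrArg (c y • ·) (haY y).symm
    exact hy₁.2 (linearIndependent_iff'.1 hli s₁ c h4 y₁ (Finset.mem_filter.2 ⟨hy₁.1, rfl⟩))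
  have hxli' : LinearIndependent k (fun y => (⟨x y, hxM y⟩ : degreeLE 𝒜 (D * M))) :=
    LinearIndependent.of_comp (degreeLE 𝒜 (D * M)).subtype hxli
  have hfin : Finite Y := hxli'.finite
  have : Fintype Y := Fintype.ofFinite Y
  rw [finrank_span_set_eq_card hli, Set.toFinset_card]
  exact hxli'.fintype_card_le_finrank

-- In an expression of `f` by monomials of value at least `r`, those of value exactly `r` lift to
-- `k[Y]` with image concentrated in degree `r`; the others go into the error term.
variable {B} in
theorem exists_leading_part (hw : ∀ f, f ≠ 0 → w.toFun f ≠ ⊤) {r : ℤ} {f : A}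
    (hf : f ∈ w.monomialFiltration B r) : ∃ (p : MvPolynomial B k) (g : A),
      (w.leadMap B p : AddMonoidAlgebra A ℤ) = AddMonoidAlgebra.single r g ∧
        f - g ∈ w.monomialFiltration B (r + 1) := by
  have hlead : ∀ x ∈ Submonoid.closure B, ∃ p : MvPolynomial B k, w.leadMap B p = w.lead x := by
    intro x hx
    induction hx using Submonoid.closure_induction with
    | mem x hx => exact ⟨MvPolynomial.X ⟨x, hx⟩, MvPolynomial.aeval_X _ _⟩
    | one => exact ⟨1, by rw [lead_one, _root_.map_one]⟩
    | mul x y _ _ h1 h2 =>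
      obtain ⟨p, hp⟩ := h1
      obtain ⟨q, hq⟩ := h2
      exact ⟨p * q, by rw [w.lead_mul hw, _root_.map_mul, hp, hq]⟩
  induction hf using Submodule.span_induction with
  | mem x hx =>
    rcases hx.2.lt_or_eq with h | h
    · refine ⟨0, 0, by simp, ?_⟩
      rw [sub_zero]
      exact w.mem_monomialFiltration B hx.1 (w.mem_Ggt_iff_mem_G.1 h)
    · obtain ⟨p, hp⟩ := hlead x hx.1
      refine ⟨p, x, ?_, by simp⟩
      rw [hp]
      change AddMonoidAlgebra.single _ _ = _
      rw [← h]
      rfl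
  | zero => exact ⟨0, 0, by simp, by simp⟩
  | add x y _ _ h1 h2 =>
    obtain ⟨p, g, hp, hg⟩ := h1
    obtain ⟨q, h, hq, hh⟩ := h2
    refine ⟨p + q, g + h, ?_, ?_⟩
    · rw [_root_.map_add, AddMonoidAlgebra.single_add, ← hp, ← hq]
      rfl
    · rw [add_sub_add_comm]
      exact Submodule.add_mem _ hg hh
  | smul c x _ h1 =>
    obtain ⟨p, g, hp, hg⟩ := h1
    refine ⟨c • p, c • g, ?_, ?_⟩
    · rw [map_smul, ← AddMonoidAlgebra.smul_single, ← hp]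
      rfl
    · rw [← smul_sub]
      exact Submodule.smul_mem _ c hg

/-- If the graded algebra of the filtration by monomials in a finite Khovanskii basis is a domain,
then the filtration is the one defined by the valuation. -/
theorem mem_monomialFiltration_succ [IsAlgClosed k] (𝒜 : ℕ → Submodule k A) [GradedAlgebra 𝒜]
    [∀ n, FiniteDimensional k (𝒜 n)] (hw : ∀ f, f ≠ 0 → w.toFun f ≠ ⊤)
    (hbdd : ∀ E : Submodule k A, FiniteDimensional k E →
      ∃ R : ℤ, ∀ f ∈ E, f ≠ 0 → w.toFun f ≤ R)
    (hgr : ∀ f n, w.toFun f ≤ w.toFun (DirectSum.decompose 𝒜 f n : A))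
    (hB : B.Finite) (h0 : (0 : A) ∉ B) (hK : w.IsKhovanskiiBasis B)
    (hprime : ∀ r s, ∀ f ∈ w.monomialFiltration B r, ∀ g ∈ w.monomialFiltration B s,
      f * g ∈ w.monomialFiltration B (r + s + 1) →
        f ∈ w.monomialFiltration B (r + 1) ∨ g ∈ w.monomialFiltration B (s + 1))
    {r : ℤ} {f : A} (hf : f ∈ w.monomialFiltration B r) (hfr : f ∈ w.G (r + 1)) :
    f ∈ w.monomialFiltration B (r + 1) := by
  have hp := w.monomialIdeal_isPrime hw h0 hprime
  suffices hker : RingHom.ker (w.initialMap B) ≤ w.monomialIdeal hw h0 by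
    obtain ⟨p, g, hpg, hg⟩ := w.exists_leading_part hw hf
    have hgr : g ∈ w.G (r + 1) :=
      (Submodule.sub_mem_iff_right _ hfr).1 (w.monomialFiltration_le_G B _ hg)
    have hp : p ∈ w.monomialIdeal hw h0 := by
      refine hker ?_
      rw [RingHom.mem_ker, initialMap_eq_zero_iff, hpg]
      exact AddMonoidAlgebra.coeff_single_mem (P := w.Ggt) (w.mem_Ggt_iff_mem_G.2 hgr)
    have h1 := hp r
    rw [hpg, AddMonoidAlgebra.coeff_single, Finsupp.single_eq_same] at h1
    exact (Submodule.sub_mem_iff_left _ h1).1 hg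
  by_contra hcon
  obtain ⟨p, hpker, hpI⟩ := Set.not_subset.1 hcon
  rw [SetLike.mem_coe, RingHom.mem_ker] at hpker
  have : Fintype B := hB.fintype
  set q := Ideal.Quotient.mkₐ k (w.monomialIdeal hw h0)
  let l : (MvPolynomial B k ⧸ w.monomialIdeal hw h0) →ₐ[k] w.gr :=
    Ideal.Quotient.liftₐ _ (w.initialMap B) (fun a ha => w.monomialIdeal_le_ker hw h0 ha)
  have hlq : l.toLinearMap ∘ₗ q.toLinearMap = (w.initialMap B).toLinearMap := by
    apply LinearMap.ext
    intro x
    rfl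
  obtain ⟨c, hc⟩ := w.exists_initialForm_mem_map B 𝒜 hw hgr hB hK
  choose! deg hdeg using fun b : A => degreeLE.exists_mem 𝒜 b
  set D := hB.toFinset.sup deg
  have hD : ∀ b ∈ B, b ∈ degreeLE 𝒜 D := fun b hb =>
    degreeLE.mono 𝒜 (Finset.le_sup (hB.mem_toFinset.2 hb)) (hdeg b)
  set U : ℕ → Submodule k (MvPolynomial B k ⧸ w.monomialIdeal hw h0) := fun M =>
    (MvPolynomial.restrictTotalDegree B k M).map q.toLinearMap with hU
  set V : ℕ → Submodule k w.gr := fun M =>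
    (MvPolynomial.restrictTotalDegree B k M).map (w.initialMap B).toLinearMap with hV
  have hmono : ∀ {M N : ℕ}, M ≤ N →
      MvPolynomial.restrictTotalDegree B k M ≤ MvPolynomial.restrictTotalDegree B k N := by
    intro M N h x hx
    rw [MvPolynomial.mem_restrictTotalDegree] at *
    exact hx.trans h
  -- `U` and `V` are the images in the domain and in `gr_w(A)`. The constant `c * D` passes from
  -- polynomials to `A` and back; adding 1 keeps it positive. The shift is the degree of a
  -- polynomial `p` in the kernel but not in the ideal.
  refine false_of_growth (h := fun M => Module.finrank k (U M))
    (g := fun M => Module.finrank k (V M)) (C := c * D + 1) (d := p.totalDegree)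
    (e := Fintype.card B) (by omega) (fun M => ?_) (fun M N h => ?_) (fun M => ?_) (fun M => ?_)
    (fun M => ?_)
  · refine Submodule.one_le_finrank_iff.2 fun hbot => ?_
    have h1 : q 1 ∈ U M := ⟨1, by
      rw [SetLike.mem_coe, MvPolynomial.mem_restrictTotalDegree]
      simp, rfl⟩
    rw [hbot, Submodule.mem_bot, _root_.map_one] at h1
    exact one_ne_zero h1
  · exact Submodule.finrank_mono (Submodule.map_mono (hmono h))
  · refine (w.finrank_map_mk_le hw h0 𝒜 hD M).trans ?_
    refine w.finrank_le_of_initialForm_mem hw _ (hbdd _ inferInstance) _ fun f hf => ?_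
    refine Submodule.map_mono (hmono ?_) (hc _ f hf)
    nlinarith
  · have h1 : (U (M + p.totalDegree)).map l.toLinearMap = V (M + p.totalDegree) := by
      rw [hU, hV, ← Submodule.map_comp, hlq]
    have h2 := LinearMap.finrank_range_add_finrank_ker
      (l.toLinearMap.domRestrict (U (M + p.totalDegree)))
    rw [LinearMap.range_domRestrict, h1] at h2
    -- Multiplication by the class of `p` is injective, since the quotient is a domain, and embeds
    -- `U M` into the kernel of `U (M + deg p) → V (M + deg p)`.
    have h3 : Module.finrank k (U M) ≤ Module.finrank k
        (LinearMap.ker (l.toLinearMap.domRestrict (U (M + p.totalDegree)))) := by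
      have hqp : q p ≠ 0 := fun h => hpI (Ideal.Quotient.eq_zero_iff_mem.1 h)
      have hinj : Function.Injective (LinearMap.mulLeft k (q p)) := fun x y hxy =>
        mul_left_cancel₀ hqp hxy
      rw [← Submodule.finrank_map_subtype_eq,
        (Submodule.equivMapOfInjective _ hinj (U M)).finrank_eq]
      refine Submodule.finrank_mono ?_
      rintro _ ⟨_, ⟨x, hx, rfl⟩, rfl⟩
      have hmem : q p * q x ∈ U (M + p.totalDegree) := by
        refine ⟨p * x, ?_, _root_.map_mul q p x⟩
        rw [SetLike.mem_coe, MvPolynomial.mem_restrictTotalDegree] at hx ⊢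
        refine (MvPolynomial.totalDegree_mul p x).trans ?_
        omega
      refine ⟨⟨q p * q x, hmem⟩, ?_, rfl⟩
      rw [SetLike.mem_coe, LinearMap.mem_ker]
      change l (q p * q x) = 0
      have hlp : l (q p) = 0 := hpker
      rw [_root_.map_mul, hlp, zero_mul]
    omega
  · exact (Submodule.finrank_map_le _ _).trans (MvPolynomial.finrank_restrictTotalDegree_le M)

end IntValuation

/-! ## Support functions and their values at the rays -/

namespace SmoothFan

variable {N : Type*} [AddCommGroup N] (F : SmoothFan N)

instance : Finite F.Ray :=
  Finite.of_injective (fun i : F.Ray => (⟨{i.1}, i.2⟩ : F.cones)) fun _ _ h =>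
    Subtype.ext (Finset.singleton_injective (congrArg Subtype.val h))

/-- A cone of the fan, generator by generator, has a linear function with prescribed values. -/
theorem exists_linear (φ : F.Ray → ℤ) {σ : Finset N} (hσ : σ ∈ F.cones) :
    ∃ m : N →+ ℤ, ∀ i : F.Ray, i.1 ∈ σ → m i.1 = φ i := by
  classical
  obtain ⟨e, he⟩ := F.smooth σ hσ
  -- Basis vectors that are not ray generators get the arbitrary value 0.
  refine ⟨(e.constr ℤ fun j => if h : {e j} ∈ F.cones then φ ⟨e j, h⟩ else 0).toAddMonoidHom,
    fun i hi => ?_⟩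
  obtain ⟨j, hj⟩ := he hi
  obtain ⟨i, hi'⟩ := i
  change e j = i at hj
  subst hj
  change (e.constr ℤ _) (e j) = _
  rw [Module.Basis.constr_basis, dif_pos hi']

/-- The values of a support function at the rays. -/
def rayEval : F.supportFunctions →+ (F.Ray → ℤ) where
  toFun ψ i := (ψ : F.supp → ℤ) (F.rayPoint i)
  map_zero' := rfl
  map_add' _ _ := rfl

theorem rayPoint_mem_closure {σ : Finset N} {i : F.Ray} (hi : i.1 ∈ σ) :
    ((F.rayPoint i : F.supp) : N) ∈ AddSubmonoid.closure (σ : Set N) :=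
  AddSubmonoid.subset_closure hi

theorem rayEval_injective : Function.Injective F.rayEval := by
  rw [injective_iff_map_eq_zero]
  intro ψ hψ
  apply Subtype.ext
  funext ρ
  obtain ⟨σ, hσ, hρ⟩ := ρ.2
  obtain ⟨m, hm⟩ := ψ.2 σ hσ
  change (ψ : F.supp → ℤ) ρ = 0
  rw [hm ρ hρ]
  generalize (ρ : N) = x at hρ
  induction hρ using AddSubmonoid.closure_induction with
  | mem x hx =>
    let i : F.Ray := ⟨x, F.face_mem σ hσ {x} (Finset.singleton_subset_iff.2 hx)⟩
    exact (hm (F.rayPoint i) (F.rayPoint_mem_closure hx)).symm.trans (congrFun hψ i)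
  | zero => exact map_zero m
  | add x y _ _ hx hy => rw [map_add, hx, hy, add_zero]

/-- Linear functions chosen cone by cone glue: the intersection of two cones is generated by their
common rays, where both functions have the prescribed values. -/
theorem rayEval_surjective : Function.Surjective F.rayEval := by
  intro φ
  choose! m hm using fun σ (hσ : σ ∈ F.cones) => F.exists_linear φ hσ
  choose τ hτ hmem using fun ρ : F.supp => ρ.2
  have hagree : ∀ σ ∈ F.cones, ∀ τ ∈ F.cones, ∀ x ∈ AddSubmonoid.closure (σ : Set N),
      x ∈ AddSubmonoid.closure (τ : Set N) → m σ x = m τ x := by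
    intro σ hσ τ hτ x hxσ hxτ
    have hx := F.inter_le σ hσ τ hτ ⟨hxσ, hxτ⟩
    clear hxσ hxτ
    induction hx using AddSubmonoid.closure_induction with
    | mem x hx =>
      let i : F.Ray := ⟨x, F.face_mem σ hσ {x} (Finset.singleton_subset_iff.2 hx.1)⟩
      rw [hm σ hσ i hx.1, hm τ hτ i hx.2]
    | zero => rw [map_zero, map_zero]
    | add x y _ _ hx hy => rw [map_add, map_add, hx, hy]
  refine ⟨⟨fun ρ => m (τ ρ) ρ, fun σ hσ => ⟨m σ, fun ρ hρ =>
    hagree _ (hτ ρ) _ hσ _ (hmem ρ) hρ⟩⟩, ?_⟩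
  funext i
  exact (hagree _ (hτ (F.rayPoint i)) _ i.2 _ (hmem (F.rayPoint i))
    (F.rayPoint_mem_closure (Finset.mem_singleton_self i.1))).trans
      (hm _ i.2 i (Finset.mem_singleton_self i.1))

/-- The group of integral support functions of a smooth fan is the group of functions on the
rays. -/
noncomputable def rayEquiv : F.supportFunctions ≃+ (F.Ray → ℤ) :=
  AddEquiv.ofBijective F.rayEval ⟨F.rayEval_injective, F.rayEval_surjective⟩

theorem rayEquiv_apply (ψ : F.supportFunctions) (i : F.Ray) :
    F.rayEquiv ψ i = (ψ : F.supp → ℤ) (F.rayPoint i) := rfl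

end SmoothFan

/-! ## Values of a valuation with linear adapted bases -/

namespace FanValuation

variable {k N A : Type*} [Field k] [AddCommGroup N] [CommRing A] [Algebra k A]
  {F : SmoothFan N} (v : FanValuation k A F)

variable {v} in
theorem ne_top (hflat : v.HasLinearAdaptedBases) (ρ : F.supp) (f : A) (hf : f ≠ 0) :
    v.toFun f ρ ≠ ⊤ := by
  obtain ⟨σ, hσ, hρ⟩ := ρ.2
  obtain ⟨κ, β, m, h⟩ := hflat σ hσ
  rw [h f ρ hρ]
  have hne : (β.repr f).support.Nonempty := by
    rw [Finsupp.support_nonempty_iff]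
    simpa using hf
  obtain ⟨b, -, hb⟩ := Finset.exists_mem_eq_inf _ hne
    fun b => ((m b (ρ : N) : ℤ) : WithTop ℤ)
  rw [hb]
  exact WithTop.coe_ne_top

-- Only finitely many adapted basis elements occur in `E`, and their linear functions at `ρ` bound
-- all values. This provides the maximal values needed to compare `E` with its initial forms.
variable {v} in
theorem exists_bound (hflat : v.HasLinearAdaptedBases) (ρ : F.supp) (E : Submodule k A)
    (hE : FiniteDimensional k E) : ∃ R : ℤ, ∀ f ∈ E, f ≠ 0 → v.toFun f ρ ≤ R := by
  classical
  obtain ⟨σ, hσ, hρ⟩ := ρ.2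
  obtain ⟨κ, β, m, h⟩ := hflat σ hσ
  obtain ⟨S, hS⟩ := (Submodule.fg_iff_finiteDimensional E).2 hE
  let K : Finset κ := S.biUnion fun f => (β.repr f).support
  have hK : ∀ f ∈ E, (β.repr f).support ⊆ K := by
    intro f hf
    have h1 : E ≤ (Finsupp.supported k k (K : Set κ)).comap β.repr.toLinearMap := by
      rw [← hS, Submodule.span_le]
      intro g hg
      exact Finset.coe_subset.2 (Finset.subset_biUnion_of_mem (fun f => (β.repr f).support) hg)
    exact Finset.coe_subset.1 (h1 hf)
  obtain ⟨R, hR⟩ := (K.image fun b => m b (ρ : N)).bddAbove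
  refine ⟨R, fun f hf hf0 => ?_⟩
  have hne : (β.repr f).support.Nonempty := by
    rw [Finsupp.support_nonempty_iff]
    simpa using hf0
  obtain ⟨b, hb⟩ := hne
  rw [h f ρ hρ]
  refine (Finset.inf_le hb).trans (WithTop.coe_le_coe.2 (hR ?_))
  exact Finset.mem_coe.2 (Finset.mem_image_of_mem _ (hK f hf hb))

/-- The elements whose values at the rays are at least `φ`. -/
def raySpace (φ : F.Ray → ℤ) : Submodule k A :=
  ⨅ i, (v.atPoint (F.rayPoint i)).G (φ i)

theorem mem_raySpace {φ : F.Ray → ℤ} {f : A} :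
    f ∈ v.raySpace φ ↔ ∀ i, ((φ i : ℤ) : WithTop ℤ) ≤ v.toFun f (F.rayPoint i) := by
  simp only [raySpace, Submodule.mem_iInf]
  rfl

theorem one_mem_raySpace : (1 : A) ∈ v.raySpace 0 :=
  v.mem_raySpace.2 fun i => by
    have h : v.toFun 1 (F.rayPoint i) = 0 := (v.atPoint (F.rayPoint i)).map_one
    simp [h]

theorem mul_mem_raySpace {φ ψ : F.Ray → ℤ} {f g : A} (hf : f ∈ v.raySpace φ)
    (hg : g ∈ v.raySpace ψ) : f * g ∈ v.raySpace (φ + ψ) := by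
  rw [mem_raySpace] at *
  intro i
  have h := add_le_add (hf i) (hg i)
  rw [v.map_mul]
  simpa using h

theorem raySpace_antitone : Antitone v.raySpace := fun _ _ h _ hf =>
  v.mem_raySpace.2 fun i => (WithTop.coe_le_coe.2 (h i)).trans (v.mem_raySpace.1 hf i)

variable {v} in
/-- Sections of the line bundle of a support function are determined by the values at the rays. -/
theorem sectionSpace_eq_raySpace (hflat : v.HasLinearAdaptedBases) (ψ : F.supportFunctions) :
    v.sectionSpace ψ = v.raySpace (F.rayEquiv ψ) := by
  ext f
  rw [mem_sectionSpace, mem_raySpace]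
  refine ⟨fun h i => h _, fun h ρ => ?_⟩
  obtain ⟨σ, hσ, hρ⟩ := ρ.2
  obtain ⟨κ, β, m, hβ⟩ := hflat σ hσ
  obtain ⟨l, hl⟩ := ψ.2 σ hσ
  rw [hβ f ρ hρ, hl ρ hρ]
  -- Each linear function occurring in the minimum dominates `l` at the generators of the cone,
  -- hence at every lattice point of it.
  refine Finset.le_inf fun b hb => WithTop.coe_le_coe.2 ?_
  generalize (ρ : N) = x at hρ
  induction hρ using AddSubmonoid.closure_induction with
  | mem x hx =>
    let i : F.Ray := ⟨x, F.face_mem σ hσ {x} (Finset.singleton_subset_iff.2 hx)⟩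
    have h1 := h i
    have hi := F.rayPoint_mem_closure (i := i) hx
    rw [F.rayEquiv_apply, hl _ hi, hβ f _ hi] at h1
    exact WithTop.coe_le_coe.1 (h1.trans (Finset.inf_le hb))
  | zero => rw [_root_.map_zero, _root_.map_zero]
  | add x y _ _ hx hy =>
    rw [_root_.map_add, _root_.map_add]
    exact add_le_add hx hy

/-! ## The algebra generated by the lifted generators -/

variable (B : Set A)

variable {v} in
theorem mem_raySpace_rayValues (hflat : v.HasLinearAdaptedBases) (f : A) :
    f ∈ v.raySpace (v.rayValues f) := by
  rw [mem_raySpace]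
  intro i
  by_cases hf : f = 0
  · simp [hf, v.map_zero]
  · exact ((v.atPoint (F.rayPoint i)).untopD_coe (ne_top hflat _ f hf)).le

variable {v} in
theorem le_rayValues (hflat : v.HasLinearAdaptedBases) {f : A} (hf : f ≠ 0) {φ : F.Ray → ℤ}
    (h : f ∈ v.raySpace φ) : φ ≤ v.rayValues f := fun i => by
  have h1 : ((φ i : ℤ) : WithTop ℤ) ≤ (v.atPoint (F.rayPoint i)).toFun f := v.mem_raySpace.1 h i
  rw [← (v.atPoint (F.rayPoint i)).untopD_coe (ne_top hflat _ f hf), WithTop.coe_le_coe] at h1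
  exact h1

/-- The homogeneous piece of the subalgebra generated by the lifts of the elements of `B`. -/
def piece (φ : F.Ray → ℤ) : Submodule k A where
  carrier := {f | AddMonoidAlgebra.single φ f ∈ (v.presentationMap B).range}
  add_mem' := fun hf hg => by
    rw [Set.mem_ofPred_eq, AddMonoidAlgebra.single_add]
    exact add_mem hf hg
  zero_mem' := by
    rw [Set.mem_ofPred_eq, AddMonoidAlgebra.single_zero]
    exact zero_mem _
  smul_mem' := fun c f hf => by
    rw [Set.mem_ofPred_eq, ← AddMonoidAlgebra.smul_single]
    exact Subalgebra.smul_mem _ hf c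

theorem mem_piece {φ : F.Ray → ℤ} {f : A} :
    f ∈ v.piece B φ ↔ AddMonoidAlgebra.single φ f ∈ (v.presentationMap B).range := Iff.rfl

theorem one_mem_piece : (1 : A) ∈ v.piece B 0 := one_mem (v.presentationMap B).range

theorem mul_mem_piece {φ ψ : F.Ray → ℤ} {f g : A} (hf : f ∈ v.piece B φ) (hg : g ∈ v.piece B ψ) :
    f * g ∈ v.piece B (φ + ψ) := by
  rw [mem_piece, ← AddMonoidAlgebra.single_mul_single]
  exact mul_mem hf hg

open Classical in
theorem presentationMap_inl (i : F.Ray) :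
    v.presentationMap B (MvPolynomial.X (Sum.inl i)) =
      AddMonoidAlgebra.single (-(Pi.single i 1)) 1 := by
  rw [presentationMap, MvPolynomial.aeval_X]
  rfl

theorem presentationMap_inr (b : B) :
    v.presentationMap B (MvPolynomial.X (Sum.inr b)) =
      AddMonoidAlgebra.single (v.rayValues (b : A)) (b : A) := by
  rw [presentationMap, MvPolynomial.aeval_X]
  rfl

theorem mem_piece_rayValues {b : A} (hb : b ∈ B) : b ∈ v.piece B (v.rayValues b) :=
  ⟨MvPolynomial.X (Sum.inr ⟨b, hb⟩), v.presentationMap_inr B ⟨b, hb⟩⟩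

theorem one_mem_piece_of_nonpos {φ : F.Ray → ℤ} (h : φ ≤ 0) : (1 : A) ∈ v.piece B φ := by
  classical
  have := Fintype.ofFinite F.Ray
  let T : AddSubmonoid (F.Ray → ℤ) :=
    { carrier := {φ | (1 : A) ∈ v.piece B φ}
      add_mem' := fun {a b} ha hb => by
        have := v.mul_mem_piece B ha hb
        rwa [one_mul] at this
      zero_mem' := v.one_mem_piece B }
  change φ ∈ T
  rw [← Finset.univ_sum_single φ]
  refine sum_mem fun i _ => ?_
  have h1 : -(Pi.single i 1 : F.Ray → ℤ) ∈ T := by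
    refine ⟨MvPolynomial.X (Sum.inl i), (v.presentationMap_inl B i).trans ?_⟩
    congr!
  have h2 : (Pi.single i (φ i) : F.Ray → ℤ) = (-(φ i)).toNat • -(Pi.single i 1) := by
    have h3 : ((-(φ i)).toNat : ℤ) = -(φ i) := Int.toNat_of_nonneg (by simpa using h i)
    rw [← natCast_zsmul, h3, neg_smul_neg, ← Pi.single_smul]
    simp
  rw [h2]
  exact AddSubmonoid.nsmul_mem _ h1 _

/-- Multiplying by a monomial in the `X_i` lowers the degree without changing the element of `A`. -/
theorem piece_antitone : Antitone (v.piece B) := fun φ ψ h f hf => by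
  have h1 := v.mul_mem_piece B hf (v.one_mem_piece_of_nonpos B (sub_nonpos.2 h))
  rwa [mul_one, add_sub_cancel] at h1

theorem coeff_presentationMap_mem {P : (F.Ray → ℤ) → Submodule k A} (hanti : Antitone P)
    (hone : 1 ∈ P 0) (hmul : ∀ p q a b, a ∈ P p → b ∈ P q → a * b ∈ P (p + q))
    (hB : ∀ b ∈ B, b ∈ P (v.rayValues b)) (p : MvPolynomial (F.Ray ⊕ B) k) (φ : F.Ray → ℤ) :
    (v.presentationMap B p).coeff φ ∈ P φ := by
  classical
  have h : ∀ p, v.presentationMap B p ∈ gradedSubalgebra P hone hmul := by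
    intro p
    induction p using MvPolynomial.induction_on with
    | C c =>
      rw [← MvPolynomial.algebraMap_eq, AlgHom.commutes]
      exact Subalgebra.algebraMap_mem _ c
    | add p q hp hq =>
      rw [_root_.map_add]
      exact add_mem hp hq
    | mul_X p j hp =>
      rw [_root_.map_mul]
      refine mul_mem hp ?_
      rcases j with i | b
      · rw [presentationMap_inl]
        refine AddMonoidAlgebra.coeff_single_mem (hanti ?_ hone)
        rw [neg_nonpos]
        exact Pi.single_nonneg.2 zero_le_one
      · rw [presentationMap_inr]
        exact AddMonoidAlgebra.coeff_single_mem (hB b b.2)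
  exact h p φ

variable {v} in
theorem coeff_presentationMap_mem_raySpace (hflat : v.HasLinearAdaptedBases)
    (p : MvPolynomial (F.Ray ⊕ B) k) (φ : F.Ray → ℤ) :
    (v.presentationMap B p).coeff φ ∈ v.raySpace φ :=
  v.coeff_presentationMap_mem B v.raySpace_antitone v.one_mem_raySpace
    (fun _ _ _ _ => v.mul_mem_raySpace) (fun b _ => mem_raySpace_rayValues hflat b) p φ

variable {v} in
theorem piece_le_raySpace (hflat : v.HasLinearAdaptedBases) (φ : F.Ray → ℤ) :
    v.piece B φ ≤ v.raySpace φ := by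
  rintro f ⟨p, hp⟩
  have h := coeff_presentationMap_mem_raySpace B hflat p φ
  rw [show v.presentationMap B p = _ from hp] at h
  rwa [AddMonoidAlgebra.coeff_single, Finsupp.single_eq_same] at h

variable {B} in
theorem exists_mem_piece (hB : Algebra.adjoin k B = ⊤) (f : A) : ∃ φ, f ∈ v.piece B φ := by
  have hf : f ∈ Algebra.adjoin k B := hB ▸ Algebra.mem_top
  induction hf using Algebra.adjoin_induction with
  | mem x hx => exact ⟨_, v.mem_piece_rayValues B hx⟩
  | algebraMap c =>
    refine ⟨0, ?_⟩
    rw [Algebra.algebraMap_eq_smul_one]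
    exact Submodule.smul_mem _ c (v.one_mem_piece B)
  | add x y _ _ hx hy =>
    obtain ⟨φ, hφ⟩ := hx
    obtain ⟨ψ, hψ⟩ := hy
    exact ⟨φ ⊓ ψ, add_mem (v.piece_antitone B inf_le_left hφ) (v.piece_antitone B inf_le_right hψ)⟩
  | mul x y _ _ hx hy =>
    obtain ⟨φ, hφ⟩ := hx
    obtain ⟨ψ, hψ⟩ := hy
    exact ⟨φ + ψ, v.mul_mem_piece B hφ hψ⟩

/-! ## The ideals `⟨I_B, X_i⟩` -/

open Classical in
theorem mem_presentationIdeal_sup_iff (i : F.Ray) {p : MvPolynomial (F.Ray ⊕ B) k} :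
    p ∈ v.presentationIdeal B ⊔ Ideal.span {MvPolynomial.X (Sum.inl i)} ↔
      ∃ y ∈ (v.presentationMap B).range,
        v.presentationMap B p = AddMonoidAlgebra.single (-(Pi.single i 1)) 1 * y := by
  rw [Submodule.mem_sup]
  constructor
  · rintro ⟨q, hq, r, hr, rfl⟩
    obtain ⟨s, rfl⟩ := Ideal.mem_span_singleton'.1 hr
    refine ⟨_, ⟨s, rfl⟩, ?_⟩
    have hq' : v.presentationMap B q = 0 := hq
    rw [_root_.map_add, hq', zero_add, _root_.map_mul, presentationMap_inl, mul_comm]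
    rfl
  · rintro ⟨_, ⟨s, rfl⟩, hs⟩
    refine ⟨p - MvPolynomial.X (Sum.inl i) * s, ?_, MvPolynomial.X (Sum.inl i) * s,
      Ideal.mul_mem_right _ _ (Ideal.subset_span rfl), by ring⟩
    change v.presentationMap B _ = 0
    rw [_root_.map_sub, hs, _root_.map_mul, presentationMap_inl]
    exact sub_self _

-- The image of `X_i` is a unit of `A[ℤⁿ]`, so divisibility by it inside the image algebra just asks
-- whether `f` still occurs one degree higher at the ray `i`.
open Classical in
theorem mem_piece_add_of_mem {i : F.Ray} {p : MvPolynomial (F.Ray ⊕ B) k} {φ : F.Ray → ℤ} {f : A}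
    (hp : v.presentationMap B p = AddMonoidAlgebra.single φ f) :
    p ∈ v.presentationIdeal B ⊔ Ideal.span {MvPolynomial.X (Sum.inl i)} ↔
      f ∈ v.piece B (φ + Pi.single i 1) := by
  rw [mem_presentationIdeal_sup_iff, hp, mem_piece]
  constructor
  · rintro ⟨y, hy, h⟩
    have h1 := congrArg (fun z => AddMonoidAlgebra.single (Pi.single i 1 : F.Ray → ℤ) (1 : A) * z) h
    simp only [← mul_assoc, AddMonoidAlgebra.single_mul_single, one_mul, add_neg_cancel] at h1
    rw [add_comm, h1, ← AddMonoidAlgebra.one_def, one_mul]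
    exact hy
  · intro h
    refine ⟨_, h, ?_⟩
    rw [AddMonoidAlgebra.single_mul_single, one_mul, neg_add_cancel_comm_assoc]

open Classical in
theorem mem_piece_or_mem_piece {i : F.Ray}
    (hprime : (v.presentationIdeal B ⊔ Ideal.span {MvPolynomial.X (Sum.inl i)}).IsPrime)
    {φ ψ : F.Ray → ℤ} {f g : A} (hf : f ∈ v.piece B φ) (hg : g ∈ v.piece B ψ)
    (hfg : f * g ∈ v.piece B (φ + ψ + Pi.single i 1)) :
    f ∈ v.piece B (φ + Pi.single i 1) ∨ g ∈ v.piece B (ψ + Pi.single i 1) := by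
  obtain ⟨p, hp⟩ := hf
  obtain ⟨q, hq⟩ := hg
  replace hp : v.presentationMap B p = AddMonoidAlgebra.single φ f := hp
  replace hq : v.presentationMap B q = AddMonoidAlgebra.single ψ g := hq
  rw [← v.mem_piece_add_of_mem B hp, ← v.mem_piece_add_of_mem B hq]
  refine hprime.mem_or_mem ?_
  rw [v.mem_piece_add_of_mem B (φ := φ + ψ) (f := f * g)]
  · exact hfg
  · rw [_root_.map_mul, hp, hq, AddMonoidAlgebra.single_mul_single]

end FanValuation

/-! ## From prime ideals to the total section ring -/

namespace FanValuation

variable {k N A : Type*} [Field k] [AddCommGroup N] [CommRing A] [Algebra k A]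
  {F : SmoothFan N} {v : FanValuation k A F} {B : Set A}

theorem mem_monomialFiltration_of_mem_piece (hflat : v.HasLinearAdaptedBases) (i : F.Ray)
    {φ : F.Ray → ℤ} {f : A} (hf : f ∈ v.piece B φ) :
    f ∈ (v.atPoint (F.rayPoint i)).monomialFiltration B (φ i) := by
  obtain ⟨p, hp⟩ := hf
  have h := v.coeff_presentationMap_mem B
    (P := fun φ => (v.atPoint (F.rayPoint i)).monomialFiltration B (φ i))
    (fun φ ψ h => (v.atPoint (F.rayPoint i)).monomialFiltration_antitone B (h i))
    ((v.atPoint (F.rayPoint i)).one_mem_monomialFiltration B)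
    (fun _ _ _ _ => (v.atPoint (F.rayPoint i)).mul_mem_monomialFiltration B)
    (fun b hb => (v.atPoint (F.rayPoint i)).mem_monomialFiltration B
      (Submonoid.subset_closure hb) (v.mem_raySpace.1 (mem_raySpace_rayValues hflat b) i)) p φ
  rw [show v.presentationMap B p = _ from hp] at h
  rwa [AddMonoidAlgebra.coeff_single, Finsupp.single_eq_same] at h

theorem rayValues_mul (hflat : v.HasLinearAdaptedBases) {x y : A} (hx : x ≠ 0) (hy : y ≠ 0) :
    v.rayValues (x * y) = v.rayValues x + v.rayValues y :=
  funext fun i => (v.atPoint (F.rayPoint i)).untopD_map_mul (ne_top hflat _ x hx)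
    (ne_top hflat _ y hy)

theorem mem_piece_rayValues_of_mem_closure (hflat : v.HasLinearAdaptedBases) {x : A}
    (hx : x ∈ Submonoid.closure B) : x ∈ v.piece B (v.rayValues x) := by
  induction hx using Submonoid.closure_induction with
  | mem x hx => exact v.mem_piece_rayValues B hx
  | one =>
    have h : v.rayValues 1 = 0 := funext fun i =>
      congrArg (WithTop.untopD 0) (v.atPoint (F.rayPoint i)).map_one
    rw [h]
    exact v.one_mem_piece B
  | mul x y _ _ hx hy =>
    by_cases hx0 : x = 0
    · rw [hx0, zero_mul]
      exact Submodule.zero_mem _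
    by_cases hy0 : y = 0
    · rw [hy0, mul_zero]
      exact Submodule.zero_mem _
    rw [rayValues_mul hflat hx0 hy0]
    exact v.mul_mem_piece B hx hy

/-- Degrees at rays other than `i` may be lowered freely, so the finitely many monomials of a
combination fit in a common degree. With `mem_monomialFiltration_of_mem_piece`, the filtration step
is the union of the pieces with `i`-th degree `r`. -/
theorem exists_mem_piece_of_mem_monomialFiltration (hflat : v.HasLinearAdaptedBases) (i : F.Ray)
    {r : ℤ} {f : A} (hf : f ∈ (v.atPoint (F.rayPoint i)).monomialFiltration B r) :
    ∃ φ : F.Ray → ℤ, φ i = r ∧ f ∈ v.piece B φ := by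
  classical
  induction hf using Submodule.span_induction with
  | mem x hx =>
    by_cases hx0 : x = 0
    · exact ⟨fun _ => r, rfl, hx0 ▸ Submodule.zero_mem _⟩
    refine ⟨Function.update (v.rayValues x) i r, Function.update_self .., ?_⟩
    refine v.piece_antitone B ?_ (mem_piece_rayValues_of_mem_closure hflat hx.1)
    rw [update_le_self_iff]
    have h := hx.2
    rw [← (v.atPoint (F.rayPoint i)).untopD_coe (ne_top hflat _ x hx0), WithTop.coe_le_coe] at h
    exact h
  | zero => exact ⟨fun _ => r, rfl, Submodule.zero_mem _⟩
  | add x y _ _ hx hy =>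
    obtain ⟨φ, hφ, hx⟩ := hx
    obtain ⟨ψ, hψ, hy⟩ := hy
    refine ⟨φ ⊓ ψ, by simp [hφ, hψ], ?_⟩
    exact add_mem (v.piece_antitone B inf_le_left hx) (v.piece_antitone B inf_le_right hy)
  | smul c x _ hx =>
    obtain ⟨φ, hφ, hx⟩ := hx
    exact ⟨φ, hφ, Submodule.smul_mem _ c hx⟩

open Classical in
theorem monomialFiltration_prime (hflat : v.HasLinearAdaptedBases) {i : F.Ray}
    (hprime : (v.presentationIdeal B ⊔ Ideal.span {MvPolynomial.X (Sum.inl i)}).IsPrime)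
    (r s : ℤ) (f : A) (hf : f ∈ (v.atPoint (F.rayPoint i)).monomialFiltration B r) (g : A)
    (hg : g ∈ (v.atPoint (F.rayPoint i)).monomialFiltration B s)
    (hfg : f * g ∈ (v.atPoint (F.rayPoint i)).monomialFiltration B (r + s + 1)) :
    f ∈ (v.atPoint (F.rayPoint i)).monomialFiltration B (r + 1) ∨
      g ∈ (v.atPoint (F.rayPoint i)).monomialFiltration B (s + 1) := by
  obtain ⟨φ, hφ, hf⟩ := exists_mem_piece_of_mem_monomialFiltration hflat i hf
  obtain ⟨ψ, hψ, hg⟩ := exists_mem_piece_of_mem_monomialFiltration hflat i hg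
  obtain ⟨χ, hχ, hfg⟩ := exists_mem_piece_of_mem_monomialFiltration hflat i hfg
  -- Lower `φ` away from `i` until the degree needed for `f * g` drops below `χ`. The coordinate at
  -- `i` is unchanged because `χ i = r + s + 1`.
  set φ' : F.Ray → ℤ := φ ⊓ (χ - ψ - Pi.single i 1) with hφ'
  have hi : φ' i = r := by
    have h : χ i - ψ i - 1 = r := by omega
    simp [hφ', hφ, h]
  have hle : φ' + ψ + Pi.single i 1 ≤ χ := by
    have h : φ' ≤ χ - ψ - Pi.single i 1 := inf_le_right
    rw [le_sub_iff_add_le, le_sub_iff_add_le] at h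
    rwa [add_right_comm] at h
  rcases v.mem_piece_or_mem_piece B hprime (v.piece_antitone B inf_le_left hf : f ∈ v.piece B φ')
    hg (v.piece_antitone B hle hfg) with h | h
  · left
    have h1 := mem_monomialFiltration_of_mem_piece hflat i h
    rwa [← hφ', Pi.add_apply, hi, Pi.single_eq_same] at h1
  · right
    have h1 := mem_monomialFiltration_of_mem_piece hflat i h
    rwa [Pi.add_apply, hψ, Pi.single_eq_same] at h1

open Classical in
theorem mem_piece_add_single [IsAlgClosed k] (𝒜 : ℕ → Submodule k A) [GradedAlgebra 𝒜]
    [∀ n, FiniteDimensional k (𝒜 n)] (hgraded : v.IsHomogeneous 𝒜)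
    (hflat : v.HasLinearAdaptedBases) (hfin : B.Finite) (hzero : (0 : A) ∉ B)
    (hB : v.IsKhovanskiiBasis B) {i : F.Ray}
    (hprime : (v.presentationIdeal B ⊔ Ideal.span {MvPolynomial.X (Sum.inl i)}).IsPrime)
    {φ : F.Ray → ℤ} {f : A} (hf : f ∈ v.piece B φ)
    (hfi : f ∈ (v.atPoint (F.rayPoint i)).G (φ i + 1)) : f ∈ v.piece B (φ + Pi.single i 1) := by
  have h1 := (v.atPoint (F.rayPoint i)).mem_monomialFiltration_succ B 𝒜
    (ne_top hflat (F.rayPoint i)) (exists_bound hflat (F.rayPoint i))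
    (fun f n => hgraded f n (F.rayPoint i)) hfin hzero (hB.2 (F.rayPoint i))
    (monomialFiltration_prime hflat hprime) (mem_monomialFiltration_of_mem_piece hflat i hf) hfi
  obtain ⟨χ, hχ, hfχ⟩ := exists_mem_piece_of_mem_monomialFiltration hflat i h1
  -- `t^ψ` is a monomial in the `X_j` with `j ≠ i`, chosen to clear the deficit of `χ` at the other
  -- rays. It is not in the prime ideal, since 1 has value 0 at `ρ_i`, so it can be cancelled.
  set ψ : F.Ray → ℤ := (χ - φ - Pi.single i 1) ⊓ 0 with hψ
  have hψi : ψ i = 0 := by simp [hψ, hχ]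
  have hle : φ + ψ + Pi.single i 1 ≤ χ := by
    have h : ψ ≤ χ - φ - Pi.single i 1 := inf_le_left
    rw [le_sub_iff_add_le, le_sub_iff_add_le] at h
    rwa [add_right_comm, add_comm ψ] at h
  have h1 : (1 : A) ∈ v.piece B ψ := v.one_mem_piece_of_nonpos B inf_le_right
  refine (v.mem_piece_or_mem_piece B hprime hf h1 ?_).resolve_right fun h => ?_
  · rw [mul_one]
    exact v.piece_antitone B hle hfχ
  · have h2 := v.mem_raySpace.1 (piece_le_raySpace B hflat _ h) i
    have h3 : v.toFun 1 (F.rayPoint i) = 0 := (v.atPoint (F.rayPoint i)).map_one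
    rw [h3, Pi.add_apply, hψi, Pi.single_eq_same, zero_add] at h2
    exact absurd (WithTop.coe_le_coe.1 h2) (by norm_num)

theorem mem_piece_of_mem_raySpace [IsAlgClosed k] (𝒜 : ℕ → Submodule k A) [GradedAlgebra 𝒜]
    [∀ n, FiniteDimensional k (𝒜 n)] (hgraded : v.IsHomogeneous 𝒜)
    (hflat : v.HasLinearAdaptedBases) (hfin : B.Finite) (hzero : (0 : A) ∉ B)
    (hB : v.IsKhovanskiiBasis B)
    (hprime : ∀ i : F.Ray,
      (v.presentationIdeal B ⊔ Ideal.span {MvPolynomial.X (Sum.inl i)}).IsPrime)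
    {φ : F.Ray → ℤ} {f : A} (hf : f ∈ v.raySpace φ) : f ∈ v.piece B φ := by
  classical
  have := Fintype.ofFinite F.Ray
  -- Induction on the total distance from `φ₀` to `φ`: at a coordinate where `φ₀` is too small, the
  -- value of `f` allows a step by `e_i`.
  have key : ∀ (n : ℕ) (φ₀ : F.Ray → ℤ), φ₀ ≤ φ → ∑ i, (φ i - φ₀ i) = n → f ∈ v.piece B φ₀ →
      f ∈ v.piece B φ := by
    intro n
    induction n with
    | zero =>
      intro φ₀ hle hsum hf₀
      rw [Nat.cast_zero, Finset.sum_eq_zero_iff_of_nonneg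
        (fun i _ => sub_nonneg.2 (hle i))] at hsum
      have h : φ₀ = φ := funext fun i => by
        have := hsum i (Finset.mem_univ i)
        omega
      exact h ▸ hf₀
    | succ n ih =>
      intro φ₀ hle hsum hf₀
      obtain ⟨i, hi⟩ : ∃ i, φ₀ i < φ i := by
        by_contra! hcon
        have h : ∑ i, (φ i - φ₀ i) ≤ 0 := Finset.sum_nonpos fun i _ => sub_nonpos.2 (hcon i)
        omega
      refine ih (φ₀ + Pi.single i 1) ?_ ?_ (mem_piece_add_single 𝒜 hgraded hflat hfin hzero hB
        (hprime i) hf₀ ?_)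
      · intro j
        by_cases hj : j = i
        · subst hj
          simpa using hi
        · simpa [hj] using hle j
      · have h : ∑ j, (Pi.single i 1 : F.Ray → ℤ) j = 1 := by simp
        have h2 : ∑ j, (φ j - (φ₀ + Pi.single i 1 : F.Ray → ℤ) j) =
            ∑ j, (φ j - φ₀ j) - ∑ j, (Pi.single i 1 : F.Ray → ℤ) j := by
          rw [← Finset.sum_sub_distrib]
          refine Finset.sum_congr rfl fun j _ => ?_
          rw [Pi.add_apply]
          ring
        rw [h2, h, hsum]
        push_cast
        ring
      · exact (WithTop.coe_le_coe.2 (by omega)).trans (v.mem_raySpace.1 hf i)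
  obtain ⟨φ₀, hφ₀⟩ := v.exists_mem_piece hB.1 f
  -- Some starting degree exists because `B` generates `A`; it may be lowered to lie below `φ`.
  have hle : φ₀ ⊓ φ ≤ φ := inf_le_right
  have hnn : 0 ≤ ∑ i, (φ i - (φ₀ ⊓ φ) i) := Finset.sum_nonneg fun i _ => sub_nonneg.2 (hle i)
  exact key _ _ hle (Int.toNat_of_nonneg hnn).symm (v.piece_antitone B inf_le_left hφ₀)

/-! ## From the total section ring to prime ideals -/

/-- Once every section is reached, lying in the ideal is a condition on values only: each
coefficient must exceed its degree at `ρ_i`. Additivity of the valuation makes this condition prime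
on homogeneous elements. -/
theorem isPrime_of_raySpace_le_piece (hflat : v.HasLinearAdaptedBases)
    (h : ∀ φ, v.raySpace φ ≤ v.piece B φ) (i : F.Ray) :
    (v.presentationIdeal B ⊔ Ideal.span {MvPolynomial.X (Sum.inl i)}).IsPrime := by
  classical
  have hrange : ∀ y : AddMonoidAlgebra A (F.Ray → ℤ), (∀ φ, y.coeff φ ∈ v.raySpace φ) →
      y ∈ (v.presentationMap B).range := by
    intro y hy
    rw [← AddMonoidAlgebra.sum_coeff_single y]
    exact sum_mem fun φ _ => h φ (hy φ)
  have hmem : ∀ p, p ∈ v.presentationIdeal B ⊔ Ideal.span {MvPolynomial.X (Sum.inl i)} ↔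
      ∀ φ, (v.presentationMap B p).coeff φ ∈ v.raySpace (φ + Pi.single i 1) := by
    intro p
    rw [mem_presentationIdeal_sup_iff]
    constructor
    · rintro ⟨_, ⟨q, rfl⟩, hq⟩ φ
      have h1 := coeff_presentationMap_mem_raySpace B hflat q (φ + Pi.single i 1)
      have h2 : (v.presentationMap B p).coeff φ =
          (v.presentationMap B q).coeff (φ + Pi.single i 1) := by
        rw [hq, AddMonoidAlgebra.coeff_single_mul_apply, one_mul, neg_neg, add_comm]
        rfl
      rwa [h2]
    · intro hp
      refine ⟨AddMonoidAlgebra.single (Pi.single i 1) 1 * v.presentationMap B p,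
        hrange _ fun φ => ?_, ?_⟩
      · rw [AddMonoidAlgebra.coeff_single_mul_apply, one_mul]
        have h1 := hp (-(Pi.single i 1) + φ)
        rwa [neg_add_cancel_comm] at h1
      · rw [← mul_assoc, AddMonoidAlgebra.single_mul_single, one_mul, neg_add_cancel,
          ← AddMonoidAlgebra.one_def, one_mul]
  refine ⟨fun htop => ?_, fun {p q} hpq => ?_⟩
  · have h1 := (hmem 1).1 (htop ▸ Submodule.mem_top) 0
    rw [_root_.map_one, AddMonoidAlgebra.one_def, AddMonoidAlgebra.coeff_single,
      Finsupp.single_eq_same] at h1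
    have h2 := v.mem_raySpace.1 h1 i
    have h3 : v.toFun 1 (F.rayPoint i) = 0 := (v.atPoint (F.rayPoint i)).map_one
    rw [h3, Pi.add_apply, Pi.single_eq_same, Pi.zero_apply, zero_add] at h2
    exact absurd (WithTop.coe_le_coe.1 h2) (by norm_num)
  · rw [hmem p, hmem q]
    refine AddMonoidAlgebra.coeff_mem_or_coeff_mem_of_mul (P := v.raySpace)
      (Q := fun φ => v.raySpace (φ + Pi.single i 1)) (fun φ ψ a ha b hb => ?_)
      (fun φ ψ a ha b hb hab => ?_) (coeff_presentationMap_mem_raySpace B hflat p)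
      (coeff_presentationMap_mem_raySpace B hflat q) (fun φ => ?_)
    · rw [add_assoc]
      exact v.mul_mem_raySpace ha hb
    · have hstep : ∀ {χ : F.Ray → ℤ} {c : A}, c ∈ v.raySpace χ →
          c ∈ (v.atPoint (F.rayPoint i)).Ggt (χ i) → c ∈ v.raySpace (χ + Pi.single i 1) := by
        intro χ c hc hci
        rw [mem_raySpace]
        intro j
        by_cases hj : j = i
        · subst hj
          rw [IntValuation.mem_Ggt_iff_mem_G] at hci
          rw [Pi.add_apply, Pi.single_eq_same]
          exact hci
        · simpa [hj] using v.mem_raySpace.1 hc j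
      by_contra! hcon
      have ha' : ¬ ((φ i : ℤ) : WithTop ℤ) < v.toFun a (F.rayPoint i) := fun h =>
        hcon.1 (hstep ha h)
      have hb' : ¬ ((ψ i : ℤ) : WithTop ℤ) < v.toFun b (F.rayPoint i) := fun h =>
        hcon.2 (hstep hb h)
      have h1 := v.mem_raySpace.1 hab i
      rw [v.map_mul, Pi.add_apply] at h1
      have h2 := h1.trans (add_le_add (not_lt.1 ha') (not_lt.1 hb'))
      rw [← WithTop.coe_add, WithTop.coe_le_coe] at h2
      simp at h2
    · have h1 := (hmem (p * q)).1 hpq φ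
      rwa [_root_.map_mul] at h1

/-! ## Strong Khovanskii bases -/

variable (v) in
/-- The total section ring, inside `A[ℤⁿ]`. -/
noncomputable def toRayAlgebra : v.sectionRing →ₐ[k] AddMonoidAlgebra A (F.Ray → ℤ) :=
  (AddMonoidAlgebra.domCongr k A F.rayEquiv : _ →ₐ[k] _).comp v.sectionRing.val

theorem toRayAlgebra_injective : Function.Injective v.toRayAlgebra :=
  (AddMonoidAlgebra.domCongr k A F.rayEquiv).injective.comp Subtype.val_injective

theorem toRayAlgebra_of_eq_single {s : v.sectionRing} {ψ : F.supportFunctions} {f : A}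
    (hs : (s : AddMonoidAlgebra A F.supportFunctions) = AddMonoidAlgebra.single ψ f) :
    v.toRayAlgebra s = AddMonoidAlgebra.single (F.rayEquiv ψ) f := by
  change AddMonoidAlgebra.domCongr k A F.rayEquiv (s : AddMonoidAlgebra A F.supportFunctions) = _
  rw [hs]
  simp [AddMonoidAlgebra.domCongr_single]

theorem toFiber_of_eq_single {s : v.sectionRing} {ψ : F.supportFunctions} {f : A}
    (hs : (s : AddMonoidAlgebra A F.supportFunctions) = AddMonoidAlgebra.single ψ f) :
    v.toFiber s = f := by
  change AddMonoidAlgebra.liftNCAlgHom (AlgHom.id k A)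
    (1 : Multiplicative F.supportFunctions →* A) (fun _ _ => Commute.all _ _)
      (s : AddMonoidAlgebra A F.supportFunctions) = _
  rw [hs]
  refine (AddMonoidAlgebra.liftNC_single _ _ _ _).trans ?_
  simp

theorem exists_section (hflat : v.HasLinearAdaptedBases) {φ : F.Ray → ℤ} {f : A}
    (hf : f ∈ v.raySpace φ) : ∃ s : v.sectionRing,
      (s : AddMonoidAlgebra A F.supportFunctions) =
        AddMonoidAlgebra.single (F.rayEquiv.symm φ) f := by
  refine ⟨⟨AddMonoidAlgebra.single (F.rayEquiv.symm φ) f,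
    AddMonoidAlgebra.coeff_single_mem ?_⟩, rfl⟩
  rwa [sectionSpace_eq_raySpace hflat, AddEquiv.apply_symm_apply]

theorem mem_raySpace_of_eq_single (hflat : v.HasLinearAdaptedBases) {s : v.sectionRing}
    {ψ : F.supportFunctions} {f : A}
    (hs : (s : AddMonoidAlgebra A F.supportFunctions) = AddMonoidAlgebra.single ψ f) :
    f ∈ v.raySpace (F.rayEquiv ψ) := by
  have h := s.2 ψ
  rw [hs, AddMonoidAlgebra.coeff_single, Finsupp.single_eq_same] at h
  rwa [← sectionSpace_eq_raySpace hflat]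

/-- A homogeneous generator `f t^ψ` with `f ∈ B` has degree at most the value vector of `f`, so it
is a Cox monomial times the image of `Y_f`. -/
theorem raySpace_le_piece_of_isStrongKhovanskiiBasis (hflat : v.HasLinearAdaptedBases)
    (hzero : (0 : A) ∉ B) (h : v.IsStrongKhovanskiiBasis B) (φ : F.Ray → ℤ) :
    v.raySpace φ ≤ v.piece B φ := by
  obtain ⟨S, hS, hgen, hSB⟩ := h
  have hle : Algebra.adjoin k (v.coxMonomials ∪ S) ≤
      (v.presentationMap B).range.comap v.toRayAlgebra := by
    rw [Algebra.adjoin_le_iff]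
    rintro s (⟨ψ, hψ, hs⟩ | hs)
    · change v.toRayAlgebra s ∈ (v.presentationMap B).range
      rw [toRayAlgebra_of_eq_single hs]
      exact v.one_mem_piece_of_nonpos B fun i => hψ (F.rayPoint i)
    · change v.toRayAlgebra s ∈ (v.presentationMap B).range
      obtain ⟨ψ, f, hf⟩ := hS s hs
      rw [toRayAlgebra_of_eq_single hf]
      have hfB : f ∈ B := by
        rw [← hSB, ← toFiber_of_eq_single hf]
        exact ⟨s, hs, rfl⟩
      have h0 : f ≠ 0 := fun h => hzero (h ▸ hfB)
      exact v.piece_antitone B (le_rayValues hflat h0 (mem_raySpace_of_eq_single hflat hf))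
        (v.mem_piece_rayValues B hfB)
  intro f hf
  obtain ⟨s, hs⟩ := exists_section hflat hf
  have h1 : s ∈ Algebra.adjoin k (v.coxMonomials ∪ S) := hgen ▸ Algebra.mem_top
  have h2 : v.toRayAlgebra s ∈ (v.presentationMap B).range := hle h1
  rwa [toRayAlgebra_of_eq_single hs, AddEquiv.apply_symm_apply] at h2

theorem isStrongKhovanskiiBasis_of_raySpace_le_piece (hflat : v.HasLinearAdaptedBases)
    (h : ∀ φ, v.raySpace φ ≤ v.piece B φ) : v.IsStrongKhovanskiiBasis B := by
  classical
  -- Each `b` is lifted to the degree given by its value vector, to match the image of `Y_b`.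
  set S : Set v.sectionRing := {s | ∃ b ∈ B, (s : AddMonoidAlgebra A F.supportFunctions) =
    AddMonoidAlgebra.single (F.rayEquiv.symm (v.rayValues b)) b} with hS
  refine ⟨S, fun s ⟨b, _, hs⟩ => ⟨_, b, hs⟩, ?_, ?_⟩
  · set T := Algebra.adjoin k (v.coxMonomials ∪ S)
    have hT : ∀ p, v.presentationMap B p ∈ T.map v.toRayAlgebra := by
      intro p
      induction p using MvPolynomial.induction_on with
      | C c =>
        rw [← MvPolynomial.algebraMap_eq, AlgHom.commutes]
        exact Subalgebra.algebraMap_mem _ c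
      | add p q hp hq =>
        rw [_root_.map_add]
        exact add_mem hp hq
      | mul_X p j hp =>
        rw [_root_.map_mul]
        refine mul_mem hp ?_
        rcases j with i | b
        · rw [presentationMap_inl]
          have hle : -(Pi.single i 1 : F.Ray → ℤ) ≤ 0 :=
            neg_nonpos.2 (Pi.single_nonneg.2 zero_le_one)
          have h1 := v.raySpace_antitone hle v.one_mem_raySpace
          obtain ⟨s, hs⟩ := exists_section hflat h1
          refine ⟨s, Algebra.subset_adjoin (Or.inl ⟨_, fun ρ => ?_, hs⟩), ?_⟩
          · have h2 := s.2 (F.rayEquiv.symm (-(Pi.single i 1)))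
            rw [hs, AddMonoidAlgebra.coeff_single, Finsupp.single_eq_same, mem_sectionSpace] at h2
            have h3 := h2 ρ
            rw [show v.toFun 1 ρ = 0 from (v.atPoint ρ).map_one] at h3
            exact WithTop.coe_le_coe.1 h3
          · refine (toRayAlgebra_of_eq_single hs).trans ?_
            rw [AddEquiv.apply_symm_apply]
        · rw [presentationMap_inr]
          obtain ⟨s, hs⟩ := exists_section hflat (mem_raySpace_rayValues hflat (b : A))
          refine ⟨s, Algebra.subset_adjoin (Or.inr ⟨b, b.2, hs⟩), ?_⟩
          refine (toRayAlgebra_of_eq_single hs).trans ?_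
          rw [AddEquiv.apply_symm_apply]
    rw [eq_top_iff]
    intro x _
    have hx : v.toRayAlgebra x ∈ T.map v.toRayAlgebra := by
      rw [← AddMonoidAlgebra.sum_coeff_single (v.toRayAlgebra x)]
      refine sum_mem fun φ _ => ?_
      have h1 : (v.toRayAlgebra x).coeff φ ∈ v.raySpace φ := by
        have h2 : (v.toRayAlgebra x).coeff φ =
            (x : AddMonoidAlgebra A F.supportFunctions).coeff (F.rayEquiv.symm φ) :=
          AddMonoidAlgebra.coeff_domCongr (R := k) F.rayEquiv _ φ
        rw [h2, ← F.rayEquiv.apply_symm_apply φ, ← sectionSpace_eq_raySpace hflat,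
          F.rayEquiv.apply_symm_apply]
        exact x.2 _
      obtain ⟨p, hp⟩ := h φ h1
      have h3 := hT p
      rwa [show v.presentationMap B p = _ from hp] at h3
    obtain ⟨y, hy, hyx⟩ := hx
    exact toRayAlgebra_injective hyx ▸ hy
  · ext f
    constructor
    · rintro ⟨s, ⟨b, hb, hs⟩, rfl⟩
      rwa [toFiber_of_eq_single hs]
    · intro hf
      obtain ⟨s, hs⟩ := exists_section hflat (mem_raySpace_rayValues hflat f)
      exact ⟨s, ⟨f, hf, hs⟩, toFiber_of_eq_single hs⟩

end FanValuation

theorem theorem1p4 {k N A : Type*} [Field k] [IsAlgClosed k]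
    [AddCommGroup N] [Module.Free ℤ N] [Module.Finite ℤ N] (F : SmoothFan N)
    [CommRing A] [Algebra k A]
    (𝒜 : ℕ → Submodule k A) [GradedAlgebra 𝒜] [∀ n, FiniteDimensional k (𝒜 n)]
    (v : FanValuation k A F) (hgraded : v.IsHomogeneous 𝒜) (hflat : v.HasLinearAdaptedBases)
    (B : Set A) (hfin : B.Finite) (hzero : (0 : A) ∉ B) (hB : v.IsKhovanskiiBasis B) :
    v.IsStrongKhovanskiiBasis B ↔
      ∀ i : F.Ray,
        (v.presentationIdeal B ⊔ Ideal.span {MvPolynomial.X (Sum.inl i)}).IsPrime := by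
  exact ⟨fun h => FanValuation.isPrime_of_raySpace_le_piece hflat
    (FanValuation.raySpace_le_piece_of_isStrongKhovanskiiBasis hflat hzero h),
    fun h => FanValuation.isStrongKhovanskiiBasis_of_raySpace_le_piece hflat fun _ _ hf =>
      FanValuation.mem_piece_of_mem_raySpace 𝒜 hgraded hflat hfin hzero hB h hf⟩
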